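/- **Theorem (Consistency of $\hat\beta$ for a fixed design).** *Setting.* Let $p\ge 0$, $r\ge 0$, $k\ge 1$ be integers, and let $(X_i,Z_i)_{i\ge 1}$ be i.i.d. random elements, $X_i$ with values in a measurable space $\mathcal X$ and law $P_X$, $Z_i$ with values in $\mathbb R^p$ and law $P_Z$, such that a regular conditional distribution $z\mapsto P_{X\mid Z=z}$ exists; fix a version of it. Let $g:\mathcal X^k\to\mathbb R$ be measurable with $\mathbb E|g(X_1,\dots,X_k)|^q<\infty$ for some $q\ge 1$, where $q>1$ if $k\ge 2$ (or let $g$ be essentially bounded for the law of $(X_1,\dots,X_k)$, the case $q=\infty$). Put $$\theta(z_1,\dots,z_k)=\int g(x_1,\dots,x_k)\,dP_{X\mid Z=z_1}(x_1)\cdots dP_{X\mid Z=z_k}(x_k).$$ Let $\mathfrak I_{k,n}$ be the set of all injective maps $\{1,\dots,k\}\to\{1,\dots,n\}$. For a measurable $K:\mathbb R^p\to\mathbb R$, bandwidths $h_n>0$ and $K_h(u)=h^{-p}K(u/h)$, let $$\hat\theta_n(z_1,\dots,z_k)=\frac{\sum_{\sigma\in\mathfrak I_{k,n}}\prod_{i=1}^kK_{h_n}(Z_{\sigma(i)}-z_i)\;g(X_{\sigma(1)},\dots,X_{\sigma(k)})}{\sum_{\sigma\in\mathfrak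 I_{k,n}}\prod_{i=1}^kK_{h_n}(Z_{\sigma(i)}-z_i)}$$ (with value $0$ where the denominator vanishes). *Stute's consistency assumptions.* (i) $h_n\to0$ and $nh_n^p\to\infty$. (ii) $K(z)\ge C_1\mathbf 1_{\{|z|_\infty\le C_2\}}$ for all $z$, for some $C_1,C_2>0$. (iii) There are a nonincreasing $H:[0,\infty)\to[0,\infty)$ with $H(t)=o(t^{-p})$ as $t\to\infty$, and $c_1,c_2>0$, such that $c_1H(|z|_\infty)\le K(z)\le c_2H(|z|_\infty)$ for all $z$. *Model.* Let $\mathcal Z\subset\mathbb R^p$, let $I\subset\mathbb R$ be open, let $\Lambda:\mathbb R\to\mathbb R$ be strictly increasing and continuously differentiable on $I$ (and arbitrary outside $I$), let $\psi:(\mathbb R^p)^k\to\mathbb R^r$ and $\beta^*\in\mathbb R^r$, and assume that $\theta(z)\in I$ and $\Lambda(\theta(z))=\psi(z)^T\beta^*$ for all $z\in\mathcal Z^k$. *Conclusion.* There is a set $N\subset(\mathbb R^p)^k$ with $P_Z^{\otimes k}(N)=0$ such that the following holds. Let $n'\ge k$, let $z'_1,\dots,z'_{n'}\in\mathcal Z$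 be fixed design points and let $\mathfrak I$ be a set of injective maps $\sigma:\{1,\dots,k\}\to\{1,\dots,n'\}$ with $z'_\sigma:=(z'_{\sigma(1)},\dots,z'_{\sigma(k)})\notin N$ for all $\sigma\in\mathfrak I$. Write $\psi_\sigma:=\psi(z'_\sigma)$. Let $\lambda_n\ge0$ with $\lambda_n\to\lambda_0$ as $n\to\infty$, and let $\hat\beta_n$ be any minimizer over $\beta\in\mathbb R^r$ of $$\frac{(n'-k)!}{n'!}\sum_{\sigma\in\mathfrak I}\big(\Lambda(\hat\theta_n(z'_\sigma))-\psi_\sigma^T\beta\big)^2+\lambda_n|\beta|_1 .$$ Let $$G_{\infty,n'}(\beta)=\frac{(n'-k)!}{n'!}\sum_{\sigma\in\mathfrak I}\big(\psi_\sigma^T(\beta^*-\beta)\big)^2+\lambda_0|\beta|_1 .$$ Then, as $n\to\infty$: 1. $G_{\infty,n'}$ has a minimizer, and the distance from $\hat\beta_n$ to the set of minimizers of $G_{\infty,n'}$ tends to $0$ in probability; 2. if $G_{\infty,n'}$ has a unique minimizer $\beta^{**}$, then $\hat\beta_n\to\beta^{**}$ in probability; 3. in particular, if $\lambda_0=0$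 and the vectors $\psi_\sigma$, $\sigma\in\mathfrak I$, span $\mathbb R^r$, then $\hat\beta_n\to\beta^*$ in probability. -/

import Mathlib

open MeasureTheory ProbabilityTheory Filter Topology Asymptotics
open scoped ENNReal BigOperators

noncomputable section

/-- The rescaled kernel `K_h(u) = h⁻ᵖ K(u / h)` on `ℝᵖ`. -/
def scaledKernel {p : ℕ} (K : (Fin p → ℝ) → ℝ) (h : ℝ) (u : Fin p → ℝ) : ℝ :=
  (h ^ p)⁻¹ * K (h⁻¹ • u)

/-- The conditional functional
`θ(z₁, …, z_k) = ∫ g(x₁, …, x_k) dP_{X | Z = z₁}(x₁) ⋯ dP_{X | Z = z_k}(x_k)`,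
where `κ z` is the conditional law of `X` given `Z = z`. -/
def condFunctional {𝒳 : Type*} [MeasurableSpace 𝒳] {p k : ℕ}
    (κ : Kernel (Fin p → ℝ) 𝒳) (g : (Fin k → 𝒳) → ℝ) (z : Fin k → Fin p → ℝ) : ℝ :=
  ∫ x, g x ∂(Measure.pi fun i => κ (z i))

/-- The conditional U-statistic `θ̂(z₁, …, z_k)` with bandwidth `h`, computed from the first `n`
observations; the sums run over all injective maps from `{1, …, k}` to `{1, …, n}`. -/
def condUStat {𝒳 : Type*} {p k : ℕ} (K : (Fin p → ℝ) → ℝ) (h : ℝ) (g : (Fin k → 𝒳) → ℝ) (n : ℕ)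
    (x : ℕ → 𝒳) (ζ : ℕ → Fin p → ℝ) (z : Fin k → Fin p → ℝ) : ℝ :=
  (∑ σ : Fin k ↪ Fin n,
      (∏ i, scaledKernel K h (ζ (σ i) - z i)) * g (fun i => x (σ i))) /
    (∑ σ : Fin k ↪ Fin n, ∏ i, scaledKernel K h (ζ (σ i) - z i))

/-- The `l₁` norm of a vector. -/
def l1Norm {r : ℕ} (β : Fin r → ℝ) : ℝ := ∑ j, |β j|

/-- The tuple `(z'_{σ(1)}, …, z'_{σ(k)})` of design points selected by `σ`. -/
def designTuple {p k n' : ℕ} (z' : Fin n' → Fin p → ℝ) (σ : Fin k ↪ Fin n') :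
    Fin k → Fin p → ℝ :=
  fun i => z' (σ i)

/-- The `l₁`-penalized least squares criterion that defines `β̂`, where `θhat` is the estimate
of the conditional functional and `S` is the collection of injective maps that is used. -/
def penalizedCriterion {p k n' r : ℕ} (S : Finset (Fin k ↪ Fin n')) (z' : Fin n' → Fin p → ℝ)
    (Λ : ℝ → ℝ) (θhat : (Fin k → Fin p → ℝ) → ℝ) (ψ : (Fin k → Fin p → ℝ) → Fin r → ℝ)
    (lam : ℝ) (β : Fin r → ℝ) : ℝ :=
  ((n' - k).factorial : ℝ) / (n'.factorial : ℝ) *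
      ∑ σ ∈ S, (Λ (θhat (designTuple z' σ)) - ψ (designTuple z' σ) ⬝ᵥ β) ^ 2
    + lam * l1Norm β

/-- The limit criterion `G_{∞,n'}`. -/
def limitCriterion {p k n' r : ℕ} (S : Finset (Fin k ↪ Fin n')) (z' : Fin n' → Fin p → ℝ)
    (ψ : (Fin k → Fin p → ℝ) → Fin r → ℝ) (βstar : Fin r → ℝ) (lam0 : ℝ) (β : Fin r → ℝ) : ℝ :=
  ((n' - k).factorial : ℝ) / (n'.factorial : ℝ) *
      ∑ σ ∈ S, (ψ (designTuple z' σ) ⬝ᵥ (βstar - β)) ^ 2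
    + lam0 * l1Norm β

/-- The set of global minimizers of a real function. -/
def argminSet {E : Type*} (F : E → ℝ) : Set E := {b | ∀ c, F b ≤ F c}

/-- Stute's consistency assumptions on the kernel `K` on `ℝᵖ` and the bandwidths `h n`.
The norm of `Fin p → ℝ` is the maximum norm. -/
structure StuteConsistency {p : ℕ} (K : (Fin p → ℝ) → ℝ) (h : ℕ → ℝ) : Prop where
  bandwidth_tendsto : Tendsto h atTop (𝓝 0)
  effective_size_tendsto : Tendsto (fun n : ℕ => (n : ℝ) * h n ^ p) atTop atTop
  lower_bound : ∃ C₁ > 0, ∃ C₂ > 0, ∀ z,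
    C₁ * (Metric.closedBall (0 : Fin p → ℝ) C₂).indicator (fun _ => (1 : ℝ)) z ≤ K z
  envelope : ∃ H : ℝ → ℝ, AntitoneOn H (Set.Ici 0) ∧ (∀ t, 0 ≤ t → 0 ≤ H t) ∧
    H =o[atTop] (fun t : ℝ => (t ^ p)⁻¹) ∧
    ∃ c₁ > 0, ∃ c₂ > 0, ∀ z, c₁ * H ‖z‖ ≤ K z ∧ K z ≤ c₂ * H ‖z‖

end

/-!
The deterministic part is the stability of the minimizers of the criterion under convergence of the
responses `Λ (θ̂ (z'_σ))` and of the penalty. For a positive limiting penalty the minimizers stay in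
a compact set and every cluster point minimizes the limit criterion
(`tendsto_infDist_argminSet_of_pos`); for a vanishing one only the fitted values converge, which
suffices since the limit criterion depends on nothing else
(`tendsto_infDist_argminSet_of_eq_zero`). Convergence in probability to a constant is treated as
convergence along a filter (`inProbability`), so that these facts and the continuity of `Λ` apply
directly. What remains is the consistency of `θ̂` at almost every tuple `z`, without any
assumption on the law `μ` of `Z` (`StuteConsistency.ae_tendsto_condUStat`).

Let `ν_{h,z}` be the probability measure with density proportional to `K((u - z) / h)` with respect
to `μ`. Four facts about it carry the proof.

* The maximal function `sup_h ∫ f dν_{h,z}` is of weak type (1,1) with respect to `μ`: since `K` is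
  comparable to a radially nonincreasing function, averages over balls dominate, and for these the
  inequality follows from the Besicovitch covering theorem (`exists_weakType_closedBall`,
  `exists_weakTypeOne_averagingKernel`).
* By interpolation it is bounded on `L^q` for `q > 1`. Iterating over all coordinates but one, and
  using the weak type inequality for the last, dominates the averages of a function of `k` variables
  with respect to `ν_{h,z_1} × ⋯ × ν_{h,z_k}` uniformly in `h` (`WeakTypeOne.exists_majorant`). This
  is where `q > 1` is needed for `k ≥ 2`.
* For almost every `z` the total weight `∫ K((u - z) / h) dμ(u)` is at least of order `h^p`, by
  differentiation of Lebesgue measure with respect to `μ`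
  (`StuteConsistency.ae_kernelMass_ge`).
* For almost every `z` the averages `∫ m dν_{h,z}` converge to `m z`
  (`StuteConsistency.ae_tendsto_lintegral_averagingKernel`).

If `g` is the indicator of a rectangle, the sum over all maps `σ` in the U-statistic is a product of
`k` local averages, which converge by Chebyshev's inequality, while the maps that are not injective
contribute a negligible part (`abs_sum_embedding_sub_prod_le`). A general `g` is approximated in
`L^q` by linear combinations `f` of such indicators. The error in the numerator has mean at most
the `ν`-average of the conditional mean of `|g - f|`, which the iterated maximal inequality makes
small at almost every tuple, uniformly in the bandwidth.
-/

/-! ### Convergence in probability as convergence along a filter -/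

/-- The filter on `ℕ × Ω` whose members are the sequences of events with probability tending to
one. The complements are measured by the outer measure, so no measurability is needed. A sequence
of random elements converges to a constant in probability iff it converges along this filter. -/
def inProbability {Ω : Type*} [MeasurableSpace Ω] (P : Measure Ω) : Filter (ℕ × Ω) where
  sets := {A | Tendsto (fun n => P {ω | (n, ω) ∉ A}) atTop (𝓝 0)}
  univ_sets := by simp
  sets_of_superset := by
    intro A B hA hAB
    exact tendsto_of_tendsto_of_tendsto_of_le_of_le tendsto_const_nhds hA (fun _ => zero_le)
      (fun n => measure_mono fun ω hω h => hω (hAB h))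
  inter_sets := by
    intro A B hA hB
    have hAB := Tendsto.add hA hB
    rw [add_zero] at hAB
    refine tendsto_of_tendsto_of_tendsto_of_le_of_le tendsto_const_nhds hAB (fun _ => zero_le)
      (fun n => ?_)
    refine (measure_mono fun ω hω => ?_).trans (measure_union_le _ _)
    by_cases h : (n, ω) ∈ A
    · exact Or.inr fun h' => hω ⟨h, h'⟩
    · exact Or.inl h

section InProbability

variable {Ω : Type*} [MeasurableSpace Ω] {P : Measure Ω}

theorem mem_inProbability {A : Set (ℕ × Ω)} :
    A ∈ inProbability P ↔ Tendsto (fun n => P {ω | (n, ω) ∉ A}) atTop (𝓝 0) := Iff.rfl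

theorem tendstoInMeasure_const_iff {E : Type*} [PseudoMetricSpace E] {f : ℕ → Ω → E} {c : E} :
    TendstoInMeasure P f atTop (fun _ => c) ↔
      Tendsto (fun a : ℕ × Ω => f a.1 a.2) (inProbability P) (𝓝 c) := by
  rw [tendstoInMeasure_iff_dist, Metric.tendsto_nhds]
  refine forall₂_congr fun ε _ => ?_
  rw [Filter.Eventually, mem_inProbability]
  simp

theorem tendsto_fst_inProbability : Tendsto Prod.fst (inProbability P) atTop := by
  intro s hs
  rw [mem_map, mem_inProbability]
  refine tendsto_const_nhds.congr' ?_
  filter_upwards [hs] with n hn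
  simp [hn]

end InProbability

/-! ### Stability of the minimizers of penalized least squares -/

section Argmin

variable {r : ℕ}

theorem l1Norm_nonneg (β : Fin r → ℝ) : 0 ≤ l1Norm β :=
  Finset.sum_nonneg fun _ _ => abs_nonneg _

theorem norm_le_l1Norm (β : Fin r → ℝ) : ‖β‖ ≤ l1Norm β :=
  (pi_norm_le_iff_of_nonneg (l1Norm_nonneg β)).2 fun j =>
    Finset.single_le_sum (f := fun j => |β j|) (fun _ _ => abs_nonneg _) (Finset.mem_univ j)

@[fun_prop]
theorem continuous_l1Norm : Continuous (l1Norm (r := r)) := by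
  unfold l1Norm
  fun_prop

@[fun_prop]
theorem continuous_dotProduct_right (v : Fin r → ℝ) : Continuous fun b : Fin r → ℝ => v ⬝ᵥ b := by
  unfold dotProduct
  fun_prop

/-- A linear map between finite-dimensional spaces has a continuous quasi-inverse. -/
theorem exists_continuous_quasiInverse {E F : Type*} [NormedAddCommGroup E] [NormedSpace ℝ E]
    [NormedAddCommGroup F] [NormedSpace ℝ F] [FiniteDimensional ℝ F] (L : E →ₗ[ℝ] F) :
    ∃ R : F →ₗ[ℝ] E, Continuous R ∧ ∀ x, L (R (L x)) = L x := by
  obtain ⟨R₀, hR₀⟩ := L.rangeRestrict.exists_rightInverse_of_surjective L.range_rangeRestrict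
  obtain ⟨R, hR⟩ := R₀.exists_extend
  refine ⟨R, R.continuous_of_finiteDimensional, fun x => ?_⟩
  have h1 : R (L x) = R₀ (L.rangeRestrict x) := by
    rw [← hR]; rfl
  have h2 := congrArg Subtype.val (LinearMap.congr_fun hR₀ (L.rangeRestrict x))
  rw [h1]
  simpa using h2

variable {τ ι : Type*} {S : Finset τ} {v : τ → Fin r → ℝ} {βstar : Fin r → ℝ} {c lam0 : ℝ}
  {l : Filter ι} {y : ι → τ → ℝ} {lam : ι → ℝ} {β : ι → Fin r → ℝ}

theorem nonempty_argminSet_limit (hc : 0 < c) (hlam0 : 0 ≤ lam0) :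
    (argminSet fun b => c * ∑ σ ∈ S, (v σ ⬝ᵥ (βstar - b)) ^ 2 + lam0 * l1Norm b).Nonempty := by
  rcases hlam0.eq_or_lt with rfl | hpos
  · refine ⟨βstar, fun b => ?_⟩
    simp only [sub_self, dotProduct_zero, zero_mul, add_zero]
    simp only [ne_eq, OfNat.ofNat_ne_zero, not_false_eq_true, zero_pow, Finset.sum_const_zero,
      mul_zero]
    positivity
  · have hcont : Continuous fun b : Fin r → ℝ =>
        c * ∑ σ ∈ S, (v σ ⬝ᵥ (βstar - b)) ^ 2 + lam0 * l1Norm b := by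
      have : ∀ σ, Continuous fun b : Fin r → ℝ => v σ ⬝ᵥ (βstar - b) := fun σ =>
        (continuous_dotProduct_right (v σ)).comp (continuous_const.sub continuous_id)
      fun_prop
    obtain ⟨b, hb⟩ := hcont.exists_forall_le (by
      refine tendsto_atTop_mono (fun b => ?_)
        (Tendsto.const_mul_atTop hpos (tendsto_norm_cocompact_atTop (E := Fin r → ℝ)))
      have h1 : 0 ≤ c * ∑ σ ∈ S, (v σ ⬝ᵥ (βstar - b)) ^ 2 :=
        mul_nonneg hc.le (Finset.sum_nonneg fun _ _ => sq_nonneg _)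
      nlinarith [norm_le_l1Norm b])
    exact ⟨b, hb⟩

/-- With a vanishing penalty the fitted values of a minimizer converge; since the limit criterion
only sees the fitted values, the minimizer, which may itself be unbounded, approaches the affine
subspace of minimizers of the limit criterion. -/
theorem tendsto_infDist_argminSet_of_eq_zero (hc : 0 < c)
    (hy : ∀ σ ∈ S, Tendsto (fun i => y i σ) l (𝓝 (v σ ⬝ᵥ βstar)))
    (hlam_nonneg : ∀ i, 0 ≤ lam i) (hlam : Tendsto lam l (𝓝 0))
    (hβ : ∀ i, β i ∈ argminSet fun b =>
      c * ∑ σ ∈ S, (y i σ - v σ ⬝ᵥ b) ^ 2 + lam i * l1Norm b) :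
    Tendsto (fun i => Metric.infDist (β i)
      (argminSet fun b => c * ∑ σ ∈ S, (v σ ⬝ᵥ (βstar - b)) ^ 2 + 0 * l1Norm b)) l (𝓝 0) := by
  have hbound : Tendsto (fun i => (c * ∑ σ ∈ S, (y i σ - v σ ⬝ᵥ βstar) ^ 2
      + lam i * l1Norm βstar) / c) l (𝓝 0) := by
    have h1 : Tendsto (fun i => ∑ σ ∈ S, (y i σ - v σ ⬝ᵥ βstar) ^ 2) l
        (𝓝 (∑ σ ∈ S, (v σ ⬝ᵥ βstar - v σ ⬝ᵥ βstar) ^ 2)) :=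
      tendsto_finsetSum _ fun σ hσ => ((hy σ hσ).sub_const _).pow 2
    have h2 := ((h1.const_mul c).add (hlam.mul_const (l1Norm βstar))).div_const c
    simpa using h2
  have hfit : ∀ σ ∈ S, Tendsto (fun i => v σ ⬝ᵥ (β i - βstar)) l (𝓝 0) := by
    intro σ hσ
    have h1 : Tendsto (fun i => (y i σ - v σ ⬝ᵥ β i) ^ 2) l (𝓝 0) := by
      refine squeeze_zero (fun _ => sq_nonneg _) (fun i => ?_) hbound
      rw [le_div_iff₀ hc]
      have h2 := hβ i βstar
      have h3 : (y i σ - v σ ⬝ᵥ β i) ^ 2 ≤ ∑ σ ∈ S, (y i σ - v σ ⬝ᵥ β i) ^ 2 :=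
        Finset.single_le_sum (f := fun σ => (y i σ - v σ ⬝ᵥ β i) ^ 2)
          (fun _ _ => sq_nonneg _) hσ
      have h4 := mul_nonneg (hlam_nonneg i) (l1Norm_nonneg (β i))
      nlinarith
    have h2 : Tendsto (fun i => y i σ - v σ ⬝ᵥ β i) l (𝓝 0) := by
      rw [tendsto_zero_iff_abs_tendsto_zero]
      simpa [Real.sqrt_sq_eq_abs, Function.comp_def] using h1.sqrt
    have h3 := (hy σ hσ).sub_const (v σ ⬝ᵥ βstar) |>.sub h2
    simp only [sub_self] at h3
    refine h3.congr fun i => ?_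
    rw [dotProduct_sub]
    ring
  let L : (Fin r → ℝ) →ₗ[ℝ] (S → ℝ) := LinearMap.pi fun σ => dotProductBilin ℝ ℝ (v σ)
  have hL : ∀ b σ, L b σ = v σ ⬝ᵥ b := fun _ _ => rfl
  obtain ⟨R, hRc, hR⟩ := exists_continuous_quasiInverse L
  have hR0 : Tendsto (fun i => ‖R (L (β i - βstar))‖) l (𝓝 0) := by
    have h1 : Tendsto (fun i => L (β i - βstar)) l (𝓝 0) :=
      tendsto_pi_nhds.2 fun σ => hfit σ σ.2
    have h2 := (hRc.tendsto 0).comp h1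
    simp only [map_zero] at h2
    exact tendsto_zero_iff_norm_tendsto_zero.1 h2
  refine squeeze_zero (fun _ => Metric.infDist_nonneg) (fun i => ?_) hR0
  have hmem : β i - R (L (β i - βstar)) ∈
      argminSet fun b => c * ∑ σ ∈ S, (v σ ⬝ᵥ (βstar - b)) ^ 2 + 0 * l1Norm b := by
    intro b
    have h0 : ∀ σ ∈ S, v σ ⬝ᵥ (βstar - (β i - R (L (β i - βstar)))) = 0 := by
      intro σ hσ
      have h1 := congrFun (hR (β i - βstar)) ⟨σ, hσ⟩
      rw [hL, hL] at h1
      have h2 : βstar - (β i - R (L (β i - βstar))) = R (L (β i - βstar)) - (β i - βstar) := by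
        abel
      rw [h2, dotProduct_sub, h1, sub_self]
    have h1 : ∑ σ ∈ S, (v σ ⬝ᵥ (βstar - (β i - R (L (β i - βstar))))) ^ 2 = 0 :=
      Finset.sum_eq_zero fun σ hσ => by rw [h0 σ hσ]; ring
    simp only [h1, mul_zero, zero_mul, add_zero]
    exact mul_nonneg hc.le (Finset.sum_nonneg fun _ _ => sq_nonneg _)
  refine (Metric.infDist_le_dist_of_mem hmem).trans ?_
  rw [dist_eq_norm, sub_sub_cancel]

/-- With a positive limiting penalty the minimizers stay in a compact set, and every cluster point
minimizes the limit criterion. -/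
theorem tendsto_infDist_argminSet_of_pos (hc : 0 < c) (hlam0 : 0 < lam0)
    (hy : ∀ σ ∈ S, Tendsto (fun i => y i σ) l (𝓝 (v σ ⬝ᵥ βstar)))
    (hlam : Tendsto lam l (𝓝 lam0))
    (hβ : ∀ i, β i ∈ argminSet fun b =>
      c * ∑ σ ∈ S, (y i σ - v σ ⬝ᵥ b) ^ 2 + lam i * l1Norm b) :
    Tendsto (fun i => Metric.infDist (β i)
      (argminSet fun b => c * ∑ σ ∈ S, (v σ ⬝ᵥ (βstar - b)) ^ 2 + lam0 * l1Norm b)) l (𝓝 0) := by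
  rw [tendsto_iff_ultrafilter]
  intro u hu
  have hlim : ∀ (b : ι → Fin r → ℝ) (b₀ : Fin r → ℝ), Tendsto b u (𝓝 b₀) →
      Tendsto (fun i => c * ∑ σ ∈ S, (y i σ - v σ ⬝ᵥ b i) ^ 2 + lam i * l1Norm (b i)) u
        (𝓝 (c * ∑ σ ∈ S, (v σ ⬝ᵥ (βstar - b₀)) ^ 2 + lam0 * l1Norm b₀)) := by
    intro b b₀ hb
    simp only [dotProduct_sub]
    refine (Tendsto.const_mul c (tendsto_finsetSum _ fun σ hσ => ?_)).add
      ((hlam.mono_left hu).mul ((continuous_l1Norm.tendsto b₀).comp hb))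
    exact (((hy σ hσ).mono_left hu).sub
      (((continuous_dotProduct_right (v σ)).tendsto b₀).comp hb)).pow 2
  have hbdd : ∀ᶠ i in (u : Filter ι), β i ∈ Metric.closedBall (0 : Fin r → ℝ)
      ((c * ∑ σ ∈ S, (v σ ⬝ᵥ (βstar - βstar)) ^ 2 + lam0 * l1Norm βstar + 1) / (lam0 / 2)) := by
    filter_upwards [(hlim (fun _ => βstar) βstar tendsto_const_nhds).eventually
      (gt_mem_nhds (lt_add_one _)), (hlam.mono_left hu).eventually
      (lt_mem_nhds (half_lt_self hlam0))] with i h1 h2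
    rw [mem_closedBall_zero_iff, le_div_iff₀ (half_pos hlam0)]
    have h3 := hβ i βstar
    have h4 : 0 ≤ c * ∑ σ ∈ S, (y i σ - v σ ⬝ᵥ β i) ^ 2 :=
      mul_nonneg hc.le (Finset.sum_nonneg fun _ _ => sq_nonneg _)
    have h5 := norm_le_l1Norm (β i)
    have h6 := norm_nonneg (β i)
    have h7 : ‖β i‖ * (lam0 / 2) ≤ l1Norm (β i) * lam i :=
      mul_le_mul h5 h2.le (half_pos hlam0).le (l1Norm_nonneg _)
    dsimp only at h3
    linarith
  obtain ⟨b, -, hb⟩ := (isCompact_closedBall _ _).ultrafilter_le_nhds (u.map β)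
    (le_principal_iff.2 hbdd)
  have hb' : Tendsto β u (𝓝 b) := hb
  have hmem : b ∈ argminSet fun b => c * ∑ σ ∈ S, (v σ ⬝ᵥ (βstar - b)) ^ 2 + lam0 * l1Norm b :=
    fun b' => le_of_tendsto_of_tendsto (hlim β b hb') (hlim (fun _ => b') b' tendsto_const_nhds)
      (Eventually.of_forall fun i => hβ i b')
  have h := ((Metric.continuous_infDist_pt (argminSet fun b =>
    c * ∑ σ ∈ S, (v σ ⬝ᵥ (βstar - b)) ^ 2 + lam0 * l1Norm b)).tendsto b).comp hb'
  rwa [Metric.infDist_zero_of_mem hmem] at h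

end Argmin

/-! ### The weak type maximal inequality -/

section WeakType

/-- The weak type (1,1) inequality for the centred maximal function of an arbitrary measure, from
the Besicovitch covering theorem. -/
theorem exists_weakType_closedBall (E : Type*) [MetricSpace E] [SecondCountableTopology E]
    [HasBesicovitchCovering E] [MeasurableSpace E] [BorelSpace E] :
    ∃ C : ℝ≥0∞, C ≠ ∞ ∧ ∀ (μ : Measure E) (f : E → ℝ≥0∞) (t : ℝ≥0∞),
      t * μ {z | ∃ r > 0, t * μ (Metric.closedBall z r) ≤ ∫⁻ u in Metric.closedBall z r, f u ∂μ} ≤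
        C * ∫⁻ u, f u ∂μ := by
  obtain ⟨N, τ, hτ, hN⟩ := HasBesicovitchCovering.no_satelliteConfig (α := E)
  refine ⟨N, by simp, fun μ f t => ?_⟩
  -- The covering theorem needs bounded radii; the general case follows by monotone limits.
  let A : ℕ → Set E := fun R => {z | ∃ r : ℝ, r > 0 ∧ r ≤ R ∧
    t * μ (Metric.closedBall z r) ≤ ∫⁻ u in Metric.closedBall z r, f u ∂μ}
  have hA : {z | ∃ r > 0, t * μ (Metric.closedBall z r) ≤ ∫⁻ u in Metric.closedBall z r, f u ∂μ} =
      ⋃ R, A R := by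
    ext z
    simp only [Set.mem_ofPred_eq, Set.mem_iUnion, A]
    constructor
    · rintro ⟨r, hr, h⟩
      obtain ⟨R, hR⟩ := exists_nat_ge r
      exact ⟨R, r, hr, hR, h⟩
    · rintro ⟨R, r, hr, -, h⟩
      exact ⟨r, hr, h⟩
  have hAmono : Monotone A := by
    rintro R R' hR z ⟨r, hr, hrR, h⟩
    exact ⟨r, hr, hrR.trans (by exact_mod_cast hR), h⟩
  rw [hA, hAmono.measure_iUnion, ENNReal.mul_iSup]
  refine iSup_le fun R => ?_
  choose rad hrad hradR hint using fun z : A R => z.2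
  let q : Besicovitch.BallPackage (A R) E :=
    { c := fun z => z, r := rad, rpos := hrad, r_bound := R, r_le := hradR }
  obtain ⟨s, hs, hcov⟩ := Besicovitch.exist_disjoint_covering_families hτ hN q
  have hcount : ∀ i, (s i).Countable := fun i =>
    (hs i).countable_of_nonempty_interior fun z _ =>
      ⟨q.c z, Metric.ball_subset_interior_closedBall (Metric.mem_ball_self (hrad z))⟩
  have hfam : ∀ i, t * μ (⋃ z ∈ s i, Metric.closedBall (q.c z) (q.r z)) ≤ ∫⁻ u, f u ∂μ := by
    intro i
    rw [measure_biUnion (hcount i) (hs i) fun _ _ => Metric.isClosed_closedBall.measurableSet,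
      ← ENNReal.tsum_mul_left]
    calc ∑' z : s i, t * μ (Metric.closedBall (q.c z) (q.r z))
        ≤ ∑' z : s i, ∫⁻ u in Metric.closedBall (q.c z) (q.r z), f u ∂μ :=
          ENNReal.tsum_le_tsum fun z => hint z
      _ = ∫⁻ u in ⋃ z ∈ s i, Metric.closedBall (q.c z) (q.r z), f u ∂μ :=
          (lintegral_biUnion (hcount i)
            (fun _ _ => Metric.isClosed_closedBall.measurableSet) (hs i) f).symm
      _ ≤ ∫⁻ u, f u ∂μ := setLIntegral_le_lintegral _ _
  have hsub : A R ⊆ ⋃ i, ⋃ z ∈ s i, Metric.closedBall (q.c z) (q.r z) := by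
    intro z hz
    refine (Set.iUnion_mono fun i => Set.iUnion₂_mono fun z _ => Metric.ball_subset_closedBall)
      (hcov ⟨⟨z, hz⟩, rfl⟩)
  calc t * μ (A R) ≤ t * ∑ i, μ (⋃ z ∈ s i, Metric.closedBall (q.c z) (q.r z)) := by
        gcongr
        refine (measure_mono hsub).trans ?_
        exact (measure_iUnion_le _).trans_eq (tsum_fintype _)
    _ = ∑ i, t * μ (⋃ z ∈ s i, Metric.closedBall (q.c z) (q.r z)) := Finset.mul_sum _ _ _
    _ ≤ ∑ _i : Fin N, ∫⁻ u, f u ∂μ := Finset.sum_le_sum fun i _ => hfam i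
    _ = N * ∫⁻ u, f u ∂μ := by simp

/-- If one measure dominates another on the closed balls around `z`, then it does so on integrals
of nonincreasing functions of the distance to `z`: the superlevel sets of such a function are
increasing unions of closed balls. -/
theorem lintegral_antitone_dist_le {E : Type*} [MetricSpace E] [MeasurableSpace E] [BorelSpace E]
    {ν₁ ν₂ : Measure E} [IsFiniteMeasure ν₂] {z : E}
    (h : ∀ r > 0, ν₁ (Metric.closedBall z r) ≤ ν₂ (Metric.closedBall z r))
    {φ : ℝ → ℝ} (hφ : AntitoneOn φ (Set.Ici 0)) (hφ0 : ∀ t, 0 ≤ t → 0 ≤ φ t) :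
    ∫⁻ u, ENNReal.ofReal (φ (dist u z)) ∂ν₁ ≤ ∫⁻ u, ENNReal.ofReal (φ (dist u z)) ∂ν₂ := by
  -- The superlevel set may be the single point `z`, so radius zero is included by continuity.
  have h0 : ∀ r, 0 ≤ r → ν₁ (Metric.closedBall z r) ≤ ν₂ (Metric.closedBall z r) := by
    intro r hr
    have hlim : Tendsto (fun n : ℕ => ν₂ (Metric.closedBall z (r + 1 / (n + 1)))) atTop
        (𝓝 (ν₂ (⋂ n : ℕ, Metric.closedBall z (r + 1 / (n + 1))))) := by
      refine tendsto_measure_iInter_atTop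
        (fun n => Metric.isClosed_closedBall.measurableSet.nullMeasurableSet) ?_
        ⟨0, measure_ne_top _ _⟩
      intro m n hmn
      refine Metric.closedBall_subset_closedBall ?_
      gcongr
    have hinter : ⋂ n : ℕ, Metric.closedBall z (r + 1 / ((n : ℝ) + 1)) = Metric.closedBall z r := by
      ext u
      simp only [Set.mem_iInter, Metric.mem_closedBall]
      constructor
      · intro hu
        refine ge_of_tendsto' (x := atTop) (f := fun n : ℕ => r + 1 / ((n : ℝ) + 1)) ?_ hu
        simpa using tendsto_one_div_add_atTop_nhds_zero_nat.const_add r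
      · intro hu n
        have : (0 : ℝ) ≤ 1 / ((n : ℝ) + 1) := by positivity
        linarith
    rw [hinter] at hlim
    refine ge_of_tendsto' hlim fun n => ?_
    have hn : (0 : ℝ) < 1 / ((n : ℝ) + 1) := by positivity
    exact (measure_mono (Metric.closedBall_subset_closedBall (by linarith))).trans
      (h _ (by linarith))
  have hseq : ∀ ρ : ℕ → ℝ, Monotone ρ → (∀ n, 0 ≤ ρ n) →
      ν₁ (⋃ n, Metric.closedBall z (ρ n)) ≤ ν₂ (⋃ n, Metric.closedBall z (ρ n)) := by
    intro ρ hρ hρ0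
    have hm : Monotone fun n => Metric.closedBall z (ρ n) :=
      fun _ _ hmn => Metric.closedBall_subset_closedBall (hρ hmn)
    rw [hm.measure_iUnion, hm.measure_iUnion]
    exact iSup_mono fun n => h0 _ (hρ0 n)
  have hmeas : Measurable fun u => φ (dist u z) := by
    have hanti : Antitone fun t => φ (max t 0) := fun a b hab =>
      hφ (Set.mem_Ici.2 (le_max_right _ _)) (Set.mem_Ici.2 (le_max_right _ _))
        (max_le_max_right 0 hab)
    have := hanti.measurable.comp (continuous_id.dist continuous_const : Continuous fun u => dist u z).measurable
    convert! this using 2 with u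
    simp
  have hnn : ∀ u, 0 ≤ φ (dist u z) := fun u => hφ0 _ dist_nonneg
  rw [lintegral_eq_lintegral_meas_lt _ (Eventually.of_forall hnn) hmeas.aemeasurable,
    lintegral_eq_lintegral_meas_lt _ (Eventually.of_forall hnn) hmeas.aemeasurable]
  refine lintegral_mono fun t => ?_
  let L : Set ℝ := {s | 0 ≤ s ∧ t < φ s}
  have hL : ∀ s ∈ L, ∀ s', 0 ≤ s' → s' ≤ s → s' ∈ L := fun s hs s' hs' hle =>
    ⟨hs', hs.2.trans_le (hφ hs' hs.1 hle)⟩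
  have hset : ∀ ρ : ℕ → ℝ, (∀ n, ρ n ∈ L) → (∀ s ∈ L, ∃ n, s ≤ ρ n) →
      {u | t < φ (dist u z)} = ⋃ n, Metric.closedBall z (ρ n) := by
    intro ρ hρ hcof
    ext u
    simp only [Set.mem_ofPred_eq, Set.mem_iUnion, Metric.mem_closedBall]
    constructor
    · exact fun hu => hcof _ ⟨dist_nonneg, hu⟩
    · rintro ⟨n, hn⟩
      exact (hL _ (hρ n) _ dist_nonneg hn).2
  rcases L.eq_empty_or_nonempty with hemp | ⟨s₀, hs₀⟩
  · have : {u | t < φ (dist u z)} = ∅ := by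
      ext u
      simp only [Set.mem_ofPred_eq, Set.mem_empty_iff_false, iff_false]
      intro hu
      have : dist u z ∈ L := ⟨dist_nonneg, hu⟩
      rw [hemp] at this
      exact this
    simp [this]
  obtain ⟨ρ, hρm, hρL, hρc⟩ : ∃ ρ : ℕ → ℝ, Monotone ρ ∧ (∀ n, ρ n ∈ L) ∧
      ∀ s ∈ L, ∃ n, s ≤ ρ n := by
    by_cases hb : BddAbove L
    · by_cases ha : sSup L ∈ L
      · exact ⟨fun _ => sSup L, monotone_const, fun _ => ha, fun s hs => ⟨0, le_csSup hb hs⟩⟩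
      · obtain ⟨ρ, hρ, -, hρt, hρL⟩ :=
          (isLUB_csSup ⟨s₀, hs₀⟩ hb).exists_seq_monotone_tendsto ⟨s₀, hs₀⟩
        refine ⟨ρ, hρ, hρL, fun s hs => ?_⟩
        have hlt : s < sSup L := lt_of_le_of_ne (le_csSup hb hs) fun h' => ha (h' ▸ hs)
        obtain ⟨n, hn⟩ := (hρt.eventually (lt_mem_nhds hlt)).exists
        exact ⟨n, hn.le⟩
    · refine ⟨fun n => n, Nat.mono_cast, fun n => ?_, fun s _ => exists_nat_ge s⟩
      obtain ⟨s, hs, hns⟩ := not_bddAbove_iff.1 hb n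
      exact hL s hs _ (Nat.cast_nonneg n) hns.le
  rw [hset ρ hρL hρc]
  exact hseq ρ hρm fun n => (hρL n).1

end WeakType

/-! ### Kernel averages -/

section Averaging

/-- The maximal function `z ↦ sup_n ∫ f dν_n(z)` of a sequence of kernels. -/
noncomputable def maximalAverage {E : Type*} [MeasurableSpace E] (ν : ℕ → Kernel E E)
    (f : E → ℝ≥0∞) (z : E) : ℝ≥0∞ :=
  ⨆ n, ∫⁻ u, f u ∂ν n z

/-- The maximal function of `ν` satisfies the weak type (1,1) inequality with constant `C`. -/
def WeakTypeOne {E : Type*} [MeasurableSpace E] (μ : Measure E) (ν : ℕ → Kernel E E)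
    (C : ℝ≥0∞) : Prop :=
  ∀ f : E → ℝ≥0∞, Measurable f → ∀ t, t * μ {z | t < maximalAverage ν f z} ≤ C * ∫⁻ u, f u ∂μ

variable {p : ℕ}

/-- The total weight `∫ K((u - z) / h) dμ(u)` of the kernel centred at `z`. -/
noncomputable def kernelMass (μ : Measure (Fin p → ℝ)) (K : (Fin p → ℝ) → ℝ) (h : ℝ)
    (z : Fin p → ℝ) : ℝ≥0∞ :=
  ∫⁻ u, ENNReal.ofReal (K (h⁻¹ • (u - z))) ∂μ

/-- The measure with density `K((u - z) / h)` with respect to `μ`, normalized to total mass one;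
it is zero where the total weight vanishes or is infinite. -/
noncomputable def averagingKernel (μ : Measure (Fin p → ℝ)) [SFinite μ] (K : (Fin p → ℝ) → ℝ)
    (h : ℝ) : Kernel (Fin p → ℝ) (Fin p → ℝ) :=
  Kernel.withDensity (Kernel.const _ μ)
    fun z u => ENNReal.ofReal (K (h⁻¹ • (u - z))) / kernelMass μ K h z

variable {μ : Measure (Fin p → ℝ)} {K : (Fin p → ℝ) → ℝ} {h : ℝ}

theorem measurable_kernel_sub (hK : Measurable K) (h : ℝ) :
    Measurable fun a : (Fin p → ℝ) × (Fin p → ℝ) => ENNReal.ofReal (K (h⁻¹ • (a.2 - a.1))) :=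
  by
  fun_prop

theorem measurable_kernelMass [SFinite μ] (hK : Measurable K) (h : ℝ) :
    Measurable (kernelMass μ K h) :=
  (measurable_kernel_sub hK h).lintegral_prod_right'

theorem measurable_kernel_div_mass [SFinite μ] (hK : Measurable K) (h : ℝ) :
    Measurable (Function.uncurry fun z u : Fin p → ℝ =>
      ENNReal.ofReal (K (h⁻¹ • (u - z))) / kernelMass μ K h z) :=
  (measurable_kernel_sub hK h).div ((measurable_kernelMass hK h).comp measurable_fst)

theorem lintegral_averagingKernel [SFinite μ] (hK : Measurable K) (z : Fin p → ℝ)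
    {f : (Fin p → ℝ) → ℝ≥0∞} (hf : Measurable f) :
    ∫⁻ u, f u ∂averagingKernel μ K h z =
      (∫⁻ u, ENNReal.ofReal (K (h⁻¹ • (u - z))) * f u ∂μ) / kernelMass μ K h z := by
  rw [averagingKernel, Kernel.lintegral_withDensity _ (measurable_kernel_div_mass hK h) _ hf,
    Kernel.const_apply]
  simp_rw [div_eq_mul_inv]
  rw [← lintegral_mul_const]
  swap
  · fun_prop
  refine lintegral_congr fun u => ?_
  ring

theorem averagingKernel_apply [SFinite μ] (hK : Measurable K) (z : Fin p → ℝ) :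
    averagingKernel μ K h z =
      μ.withDensity fun u => ENNReal.ofReal (K (h⁻¹ • (u - z))) / kernelMass μ K h z := by
  rw [averagingKernel, Kernel.withDensity_apply _ (measurable_kernel_div_mass hK h),
    Kernel.const_apply]

theorem averagingKernel_univ_le [SFinite μ] (hK : Measurable K) (z : Fin p → ℝ) :
    averagingKernel μ K h z Set.univ ≤ 1 := by
  have h1 := lintegral_averagingKernel (μ := μ) (h := h) hK z (f := 1) measurable_one
  simp only [Pi.one_apply, lintegral_one, mul_one] at h1
  rw [h1]
  exact ENNReal.div_self_le_one

/-- Averages with respect to a kernel that is comparable to a radially nonincreasing function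
satisfy the weak type (1,1) inequality. -/
theorem exists_weakTypeOne_averagingKernel [IsFiniteMeasure μ] (hK : Measurable K) {h : ℕ → ℝ}
    (hpos : ∀ n, 0 < h n) {H : ℝ → ℝ} (hH : AntitoneOn H (Set.Ici 0)) (hH0 : ∀ t, 0 ≤ t → 0 ≤ H t)
    {c₁ c₂ : ℝ} (hc₁ : 0 < c₁) (hc₂ : 0 < c₂) (hKH : ∀ z, c₁ * H ‖z‖ ≤ K z ∧ K z ≤ c₂ * H ‖z‖) :
    ∃ C : ℝ≥0∞, C ≠ ∞ ∧ WeakTypeOne μ (fun n => averagingKernel μ K (h n)) C := by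
  obtain ⟨C, hC, hball⟩ := exists_weakType_closedBall (Fin p → ℝ)
  let a := ENNReal.ofReal c₁
  let b := ENNReal.ofReal c₂
  have ha0 : a ≠ 0 := (ENNReal.ofReal_pos.2 hc₁).ne'
  have hat : a ≠ ∞ := ENNReal.ofReal_ne_top
  have hb0 : b ≠ 0 := (ENNReal.ofReal_pos.2 hc₂).ne'
  have hbt : b ≠ ∞ := ENNReal.ofReal_ne_top
  refine ⟨b / a * C, ENNReal.mul_ne_top (ENNReal.div_ne_top hbt ha0) hC, fun f hf t => ?_⟩
  by_cases ht : t = ∞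
  · simp [ht]
  -- The level `t` for kernel averages corresponds to the level `t c₁ / c₂` for averages over balls.
  let s := t * (a / b)
  have hs : s ≠ ∞ := ENNReal.mul_ne_top ht (ENNReal.div_ne_top hat hb0)
  have hst : b / a * s = t := by
    have : b / a * (a / b) = 1 := by
      rw [ENNReal.div_eq_inv_mul, ENNReal.div_eq_inv_mul, mul_mul_mul_comm, mul_comm b,
        ← mul_mul_mul_comm, ENNReal.inv_mul_cancel ha0 hat, ENNReal.inv_mul_cancel hb0 hbt, mul_one]
    rw [mul_left_comm, this, mul_one]
  have hsub : {z | t < maximalAverage (fun n => averagingKernel μ K (h n)) f z} ⊆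
      {z | ∃ r > 0, s * μ (Metric.closedBall z r) ≤ ∫⁻ u in Metric.closedBall z r, f u ∂μ} := by
    intro z hz
    by_contra hcon
    simp only [Set.mem_ofPred_eq, not_exists, not_and, not_le] at hcon
    refine not_le.2 (Set.mem_ofPred_eq ▸ hz) (iSup_le fun n => ?_ : _ ≤ t)
    rw [lintegral_averagingKernel hK z hf]
    refine ENNReal.div_le_of_le_mul ?_
    have hφ : AntitoneOn (fun x => H ((h n)⁻¹ * x)) (Set.Ici 0) := fun x hx y hy hxy =>
      hH (mul_nonneg (inv_pos.2 (hpos n)).le hx) (mul_nonneg (inv_pos.2 (hpos n)).le hy)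
        (mul_le_mul_of_nonneg_left hxy (inv_pos.2 (hpos n)).le)
    have hφ0 : ∀ x, 0 ≤ x → 0 ≤ H ((h n)⁻¹ * x) := fun x hx =>
      hH0 _ (mul_nonneg (inv_pos.2 (hpos n)).le hx)
    have hnorm : ∀ u, ‖(h n)⁻¹ • (u - z)‖ = (h n)⁻¹ * dist u z := fun u => by
      rw [norm_smul, Real.norm_of_nonneg (inv_pos.2 (hpos n)).le, dist_eq_norm]
    have : IsFiniteMeasure (s • μ) := Measure.smul_finite μ hs
    have hcomp := lintegral_antitone_dist_le (ν₁ := μ.withDensity f) (ν₂ := s • μ) (z := z)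
      (fun r hr => by
        rw [withDensity_apply _ Metric.isClosed_closedBall.measurableSet, Measure.smul_apply,
          smul_eq_mul]
        exact (hcon r hr).le) hφ hφ0
    rw [lintegral_smul_measure, smul_eq_mul] at hcomp
    have hmeasH : Measurable fun u => ENNReal.ofReal (H ((h n)⁻¹ * dist u z)) := by
      have hanti : Antitone fun t => H (max t 0) := fun a b hab =>
        hH (Set.mem_Ici.2 (le_max_right _ _)) (Set.mem_Ici.2 (le_max_right _ _))
          (max_le_max_right 0 hab)
      have := hanti.measurable.comp ((measurable_id.dist measurable_const :
        Measurable fun u => dist u z).const_mul (h n)⁻¹)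
      convert! this.ennreal_ofReal using 2 with u
      simp [max_eq_left (mul_nonneg (inv_pos.2 (hpos n)).le dist_nonneg)]
    rw [lintegral_withDensity_eq_lintegral_mul _ hf hmeasH] at hcomp
    calc ∫⁻ u, ENNReal.ofReal (K ((h n)⁻¹ • (u - z))) * f u ∂μ
        ≤ ∫⁻ u, b * (f * fun u => ENNReal.ofReal (H ((h n)⁻¹ * dist u z))) u ∂μ := by
          refine lintegral_mono fun u => ?_
          simp only [Pi.mul_apply]
          rw [mul_left_comm, mul_comm (f u)]
          gcongr
          rw [← ENNReal.ofReal_mul hc₂.le, ← hnorm]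
          exact ENNReal.ofReal_le_ofReal (hKH _).2
      _ = b * ∫⁻ u, (f * fun u => ENNReal.ofReal (H ((h n)⁻¹ * dist u z))) u ∂μ :=
          lintegral_const_mul _ (hf.mul hmeasH)
      _ ≤ b * (s * ∫⁻ u, ENNReal.ofReal (H ((h n)⁻¹ * dist u z)) ∂μ) := by gcongr
      _ = (b / a * s) * (a * ∫⁻ u, ENNReal.ofReal (H ((h n)⁻¹ * dist u z)) ∂μ) := by
          rw [show b / a * s * (a * ∫⁻ u, ENNReal.ofReal (H ((h n)⁻¹ * dist u z)) ∂μ) =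
            (b / a * a) * (s * ∫⁻ u, ENNReal.ofReal (H ((h n)⁻¹ * dist u z)) ∂μ) by ring,
            ENNReal.div_mul_cancel ha0 hat]
      _ ≤ t * kernelMass μ K (h n) z := by
          rw [hst, ← lintegral_const_mul _ hmeasH]
          gcongr
          refine lintegral_mono fun u => ?_
          rw [← ENNReal.ofReal_mul hc₁.le, ← hnorm]
          exact ENNReal.ofReal_le_ofReal (hKH _).1
  calc t * μ {z | t < maximalAverage (fun n => averagingKernel μ K (h n)) f z}
      ≤ b / a * s * μ {z | ∃ r > 0, s * μ (Metric.closedBall z r) ≤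
          ∫⁻ u in Metric.closedBall z r, f u ∂μ} := by
        rw [hst]
        gcongr
    _ ≤ b / a * (C * ∫⁻ u, f u ∂μ) := by
        rw [mul_assoc]
        exact mul_le_mul_right (hball μ f s) _
    _ = b / a * C * ∫⁻ u, f u ∂μ := by ring

end Averaging

/-! ### The strong type maximal inequality and its iteration over coordinates -/

section StrongType

theorem lintegral_rpow_le_lintegral_rpow {α : Type*} [MeasurableSpace α] {μ : Measure α}
    [IsProbabilityMeasure μ] {f : α → ℝ≥0∞} (hf : Measurable f) {q : ℝ} (hq : 1 ≤ q) :
    (∫⁻ a, f a ∂μ) ^ q ≤ ∫⁻ a, f a ^ q ∂μ := by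
  have h := eLpNorm'_le_eLpNorm'_of_exponent_le zero_lt_one hq μ hf.aestronglyMeasurable
  simp only [eLpNorm', enorm_eq_self, ENNReal.rpow_one, div_one] at h
  have h2 := ENNReal.rpow_le_rpow h (zero_le_one.trans hq)
  rwa [← ENNReal.rpow_mul, one_div, inv_mul_cancel₀ (by positivity), ENNReal.rpow_one] at h2

variable {E : Type*} [MeasurableSpace E] {μ : Measure E} {ν : ℕ → Kernel E E} {C : ℝ≥0∞} {q : ℝ}

theorem measurable_maximalAverage {f : E → ℝ≥0∞} (hf : Measurable f) :
    Measurable (maximalAverage ν f) :=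
  Measurable.iSup fun _ => hf.lintegral_kernel

/-- The part of `f` below the level `t` contributes at most `t` to its averages. -/
theorem maximalAverage_le_add (hν : ∀ n z, ν n z Set.univ ≤ 1) (f : E → ℝ≥0∞) (t : ℝ≥0∞)
    (z : E) :
    maximalAverage ν f z ≤ t + maximalAverage ν ({u | t < f u}.indicator f) z := by
  refine iSup_le fun n => ?_
  calc ∫⁻ u, f u ∂ν n z ≤ ∫⁻ u, t + {u | t < f u}.indicator f u ∂ν n z := by
        refine lintegral_mono fun u => ?_
        by_cases h : t < f u
        · simp [Set.indicator, h]
        · exact (not_lt.1 h).trans le_self_add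
    _ = t * ν n z Set.univ + ∫⁻ u, {u | t < f u}.indicator f u ∂ν n z := by
        rw [lintegral_add_left measurable_const, lintegral_const]
    _ ≤ t + maximalAverage ν ({u | t < f u}.indicator f) z := by
        gcongr
        · exact mul_le_of_le_one_right' (hν n z)
        · exact le_iSup (fun n => ∫⁻ u, {u | t < f u}.indicator f u ∂ν n z) n

/-- The weak type inequality at level `2t`, localized to the part of `f` above the level `t`. -/
theorem WeakTypeOne.mul_meas_le (hw : WeakTypeOne μ ν C) (hν : ∀ n z, ν n z Set.univ ≤ 1)
    {f : E → ℝ≥0∞} (hf : Measurable f) {t : ℝ≥0∞} (ht : t ≠ ∞) :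
    t * μ {z | 2 * t < maximalAverage ν f z} ≤ C * μ.withDensity f {u | t < f u} := by
  have hs : MeasurableSet {u | t < f u} := measurableSet_lt measurable_const hf
  rw [withDensity_apply _ hs, ← lintegral_indicator hs]
  refine le_trans ?_ (hw _ (hf.indicator hs) t)
  gcongr t * μ ?_
  intro z hz
  have h1 := lt_of_lt_of_le (show 2 * t < maximalAverage ν f z from hz)
    (maximalAverage_le_add hν f t z)
  rw [two_mul] at h1
  exact (ENNReal.add_lt_add_iff_left ht).1 h1

/-- The averages are bounded on `L^q` for `q > 1`; this is Marcinkiewicz interpolation between the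
weak type (1,1) inequality and the trivial bound on `L^∞`. -/
theorem WeakTypeOne.exists_lintegral_rpow_le [IsProbabilityMeasure μ] (hw : WeakTypeOne μ ν C)
    (hC : C ≠ ∞) (hν : ∀ n z, ν n z Set.univ ≤ 1) (hq : 1 < q) :
    ∃ D : ℝ≥0∞, D ≠ ∞ ∧ ∀ f : E → ℝ≥0∞, Measurable f →
      ∫⁻ z, maximalAverage ν f z ^ q ∂μ ≤ D * ∫⁻ z, f z ^ q ∂μ := by
  have hq0 : 0 < q := zero_lt_one.trans hq
  have hq1 : 0 < q - 1 := sub_pos.2 hq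
  have hq1' : ENNReal.ofReal (q - 1) ≠ 0 := (ENNReal.ofReal_pos.2 hq1).ne'
  refine ⟨2 ^ q * (ENNReal.ofReal q * ((C + 1) / ENNReal.ofReal (q - 1))), ?_, fun f hf => ?_⟩
  · refine ENNReal.mul_ne_top (by simp) (ENNReal.mul_ne_top ENNReal.ofReal_ne_top
      (ENNReal.div_ne_top (by simpa using hC) hq1'))
  by_cases hfin : ∫⁻ z, f z ^ q ∂μ = ∞
  · rw [hfin, ENNReal.mul_top]
    · exact le_top
    · refine mul_ne_zero (by simp) (mul_ne_zero (ENNReal.ofReal_pos.2 hq0).ne' ?_)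
      exact (ENNReal.div_pos (by simp) ENNReal.ofReal_ne_top).ne'
  have hfae : ∀ᵐ z ∂μ, f z < ∞ := by
    filter_upwards [ae_lt_top (hf.pow_const q) hfin] with z hz
    exact lt_top_iff_ne_top.2 fun h => by simp [h, hq0] at hz
  have hf1 : ∫⁻ z, f z ∂μ ≠ ∞ := by
    intro h
    have := lintegral_rpow_le_lintegral_rpow (μ := μ) hf hq.le
    rw [h, ENNReal.top_rpow_of_pos hq0] at this
    exact hfin (top_le_iff.1 this)
  have hMae : ∀ᵐ z ∂μ, maximalAverage ν f z < ∞ := by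
    have hzero : μ {z | maximalAverage ν f z = ∞} = 0 := by
      by_contra h0
      obtain ⟨t, ht⟩ := ENNReal.exists_nat_mul_gt h0 (ENNReal.mul_ne_top hC hf1)
      refine absurd (hw f hf t) (not_le.2 (ht.trans_le ?_))
      gcongr
      rename_i z
      intro hz
      simp [hz]
    rw [ae_iff]
    convert hzero using 3
    simp
  have hM := measurable_maximalAverage (ν := ν) hf
  let m : E → ℝ := fun z => (maximalAverage ν f z).toReal / 2
  have hm : ∀ᵐ z ∂μ, maximalAverage ν f z ^ q = 2 ^ q * ENNReal.ofReal (m z ^ q) := by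
    filter_upwards [hMae] with z hz
    have h1 : ENNReal.ofReal (m z) = maximalAverage ν f z / 2 := by
      rw [ENNReal.ofReal_div_of_pos two_pos, ENNReal.ofReal_toReal hz.ne]
      simp
    rw [← ENNReal.ofReal_rpow_of_nonneg (div_nonneg ENNReal.toReal_nonneg two_pos.le) hq0.le, h1,
      ← ENNReal.mul_rpow_of_nonneg _ _ hq0.le, ENNReal.mul_div_cancel (by simp) (by simp)]
  let ρ : Measure E := μ.withDensity f
  have hρae : ∀ᵐ z ∂ρ, f z < ∞ := (withDensity_absolutelyContinuous μ f).ae_le hfae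
  have hlayer : ∀ t : ℝ, 0 < t → μ {z | t < m z} * ENNReal.ofReal (t ^ (q - 1)) ≤
      (C + 1) * (ρ {z | t < (f z).toReal} * ENNReal.ofReal (t ^ (q - 1 - 1))) := by
    intro t ht
    have h1 : t ^ (q - 1) = t * t ^ (q - 1 - 1) := by
      rw [Real.rpow_sub_one ht.ne' (q - 1)]
      field_simp
    have h2 : μ {z | t < m z} ≤ μ {z | 2 * ENNReal.ofReal t < maximalAverage ν f z} := by
      refine measure_mono_ae ?_
      filter_upwards [hMae] with z hz hzt
      have hzt' : t < (maximalAverage ν f z).toReal / 2 := hzt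
      have h3 : 2 * ENNReal.ofReal t = ENNReal.ofReal (2 * t) := by
        rw [ENNReal.ofReal_mul two_pos.le]; simp
      have h4 : 2 * ENNReal.ofReal t < maximalAverage ν f z := by
        rw [h3]
        exact (ENNReal.ofReal_lt_iff_lt_toReal (by positivity) hz.ne).2 (by linarith)
      exact h4
    have h3 : ρ {z | ENNReal.ofReal t < f z} ≤ ρ {z | t < (f z).toReal} := by
      refine measure_mono_ae ?_
      filter_upwards [hρae] with z hz hzt
      exact (ENNReal.ofReal_lt_iff_lt_toReal ht.le hz.ne).1 hzt
    rw [h1, ENNReal.ofReal_mul ht.le, ← mul_assoc, ← mul_assoc]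
    gcongr ?_ * _
    calc μ {z | t < m z} * ENNReal.ofReal t
        ≤ ENNReal.ofReal t * μ {z | 2 * ENNReal.ofReal t < maximalAverage ν f z} := by
          rw [mul_comm]; gcongr
      _ ≤ C * ρ {z | ENNReal.ofReal t < f z} := hw.mul_meas_le hν hf ENNReal.ofReal_ne_top
      _ ≤ (C + 1) * ρ {z | t < (f z).toReal} := by gcongr; exact le_self_add
  rw [lintegral_congr_ae hm, lintegral_const_mul' _ _ (by simp),
    lintegral_rpow_eq_lintegral_meas_lt_mul μ
      (Eventually.of_forall fun z => div_nonneg ENNReal.toReal_nonneg two_pos.le)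
      (hM.ennreal_toReal.div_const 2).aemeasurable hq0, mul_assoc, mul_assoc]
  gcongr 2 ^ q * (ENNReal.ofReal q * ?_)
  -- The same formula with exponent `q - 1` for the measure `f μ` evaluates the upper bound.
  have hfl := lintegral_rpow_eq_lintegral_meas_lt_mul ρ (f := fun z => (f z).toReal)
    (Eventually.of_forall fun z => ENNReal.toReal_nonneg) hf.ennreal_toReal.aemeasurable hq1
  have hfq : ∫⁻ z, ENNReal.ofReal ((f z).toReal ^ (q - 1)) ∂ρ = ∫⁻ z, f z ^ q ∂μ := by
    rw [lintegral_withDensity_eq_lintegral_mul _ hf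
      (hf.ennreal_toReal.pow_const _).ennreal_ofReal]
    refine lintegral_congr_ae ?_
    filter_upwards [hfae] with z hz
    rw [Pi.mul_apply, ← ENNReal.ofReal_rpow_of_nonneg ENNReal.toReal_nonneg hq1.le,
      ENNReal.ofReal_toReal hz.ne]
    nth_rw 1 [← ENNReal.rpow_one (f z)]
    rw [← ENNReal.rpow_add_of_nonneg _ _ zero_le_one hq1.le]
    congr 1
    ring
  calc ∫⁻ t in Set.Ioi (0 : ℝ), μ {z | t < m z} * ENNReal.ofReal (t ^ (q - 1))
      ≤ ∫⁻ t in Set.Ioi (0 : ℝ),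
          (C + 1) * (ρ {z | t < (f z).toReal} * ENNReal.ofReal (t ^ (q - 1 - 1))) :=
        setLIntegral_mono' measurableSet_Ioi fun t ht => hlayer t ht
    _ = (C + 1) * ∫⁻ t in Set.Ioi (0 : ℝ),
          ρ {z | t < (f z).toReal} * ENNReal.ofReal (t ^ (q - 1 - 1)) :=
        lintegral_const_mul' _ _ (by simpa using hC)
    _ = (C + 1) / ENNReal.ofReal (q - 1) * ∫⁻ z, f z ^ q ∂μ := by
        rw [← hfq, hfl, ← mul_assoc, ENNReal.div_mul_cancel hq1' ENNReal.ofReal_ne_top]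

end StrongType

section Iterated

variable {E : Type*} [MeasurableSpace E] {μ : Measure E} [IsProbabilityMeasure μ]
  {ν : ℕ → Kernel E E} {C : ℝ≥0∞} {q : ℝ} {k : ℕ}

/-- The maximal function in the `i`-th coordinate. -/
noncomputable def coordMaximal (ν : ℕ → Kernel E E) (i : Fin k) (F : (Fin k → E) → ℝ≥0∞)
    (x : Fin k → E) : ℝ≥0∞ :=
  maximalAverage ν (fun u => F (Function.update x i u)) (x i)

theorem coordMaximal_update (i : Fin k) (F : (Fin k → E) → ℝ≥0∞) (x : Fin k → E) (z : E) :
    coordMaximal ν i F (Function.update x i z) =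
      maximalAverage ν (fun u => F (Function.update x i u)) z := by
  simp [coordMaximal]

theorem measurable_coordMaximal [∀ n, IsSFiniteKernel (ν n)] (i : Fin k)
    {F : (Fin k → E) → ℝ≥0∞} (hF : Measurable F) :
    Measurable (coordMaximal ν i F) := by
  refine Measurable.iSup fun n => ?_
  have h : Measurable fun a : (Fin k → E) × E => F (Function.update a.1 i a.2) :=
    hF.comp (measurable_pi_iff.2 fun j => by
      by_cases h : j = i
      · subst h; simpa using measurable_snd
      · simp only [Function.update_of_ne h]; fun_prop)
  exact Measurable.lintegral_kernel_prod_right' (κ := (ν n).comap (fun x : Fin k → E => x i)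
    (measurable_pi_apply i)) h

/-- Integrals over `Eᵏ` may be compared one coordinate at a time. -/
theorem lintegral_pi_mono_of_update (i : Fin k) {Φ Ψ : (Fin k → E) → ℝ≥0∞} (hΦ : Measurable Φ)
    (hΨ : Measurable Ψ) (h : ∀ x, ∫⁻ u, Φ (Function.update x i u) ∂μ ≤
      ∫⁻ u, Ψ (Function.update x i u) ∂μ) :
    ∫⁻ x, Φ x ∂Measure.pi (fun _ : Fin k => μ) ≤ ∫⁻ x, Ψ x ∂Measure.pi (fun _ : Fin k => μ) := by
  refine lintegral_le_of_lmarginal_le {i} hΦ hΨ ?_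
  rw [lmarginal_singleton, lmarginal_singleton]
  exact h

theorem lmarginal_congr_measure {s : Finset (Fin k)} {μ₁ μ₂ : Fin k → Measure E}
    (h : ∀ i ∈ s, μ₁ i = μ₂ i) (F : (Fin k → E) → ℝ≥0∞) :
    lmarginal μ₁ s F = lmarginal μ₂ s F := by
  ext x
  have : (fun i : s => μ₁ i) = fun i : s => μ₂ i := funext fun i => h i i.2
  simp only [lmarginal]
  rw [this]

/-- Averages over the coordinates in `s` are dominated by the iterated maximal function, which is
bounded on `L^q`, `q > 1`. -/
theorem WeakTypeOne.exists_iterated_majorant [∀ n, IsSFiniteKernel (ν n)]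
    (hw : WeakTypeOne μ ν C) (hC : C ≠ ∞)
    (hν : ∀ n z, ν n z Set.univ ≤ 1) (s : Finset (Fin k)) (hq : s = ∅ ∨ 1 < q) :
    ∃ D : ℝ≥0∞, D ≠ ∞ ∧ ∀ F : (Fin k → E) → ℝ≥0∞, Measurable F →
      ∃ G : (Fin k → E) → ℝ≥0∞, Measurable G ∧
        (∀ n x, lmarginal (fun j => ν n (x j)) s F x ≤ G x) ∧
        ∫⁻ x, G x ^ q ∂Measure.pi (fun _ => μ) ≤ D * ∫⁻ x, F x ^ q ∂Measure.pi (fun _ => μ) := by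
  have hfin : ∀ n z, IsFiniteMeasure (ν n z) := fun n z =>
    ⟨(hν n z).trans_lt ENNReal.one_lt_top⟩
  induction s using Finset.induction_on with
  | empty => exact ⟨1, by simp, fun F hF => ⟨F, hF, fun n x => by simp, by simp⟩⟩
  | insert i s hi ih =>
    have hq1 : 1 < q := hq.resolve_left (Finset.insert_ne_empty _ _)
    obtain ⟨D, hD, ih⟩ := ih (Or.inr hq1)
    obtain ⟨D', hD', hstrong⟩ := hw.exists_lintegral_rpow_le hC hν hq1
    refine ⟨D' * D, ENNReal.mul_ne_top hD' hD, fun F hF => ?_⟩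
    obtain ⟨G, hG, hFG, hGq⟩ := ih F hF
    refine ⟨coordMaximal ν i G, measurable_coordMaximal i hG, fun n x => ?_, ?_⟩
    · rw [lmarginal_insert F hF hi]
      refine le_trans (lintegral_mono fun u => ?_)
        (le_iSup (fun n => ∫⁻ u, G (Function.update x i u) ∂ν n (x i)) n)
      refine le_trans (le_of_eq ?_) (hFG n (Function.update x i u))
      refine congrFun (lmarginal_congr_measure (fun j hj => ?_) F) _
      rw [Function.update_of_ne (by rintro rfl; exact hi hj)]
    · calc ∫⁻ x, coordMaximal ν i G x ^ q ∂Measure.pi (fun _ => μ)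
          ≤ ∫⁻ x, D' * G x ^ q ∂Measure.pi (fun _ => μ) := by
            refine lintegral_pi_mono_of_update i ((measurable_coordMaximal i hG).pow_const q)
              ((hG.pow_const q).const_mul _) fun x => ?_
            simp only [coordMaximal_update]
            have hGx : Measurable fun u => G (Function.update x i u) :=
              hG.comp (measurable_update x)
            rw [lintegral_const_mul _ (hGx.pow_const q)]
            exact hstrong _ hGx
        _ = D' * ∫⁻ x, G x ^ q ∂Measure.pi (fun _ => μ) :=
            lintegral_const_mul _ (hG.pow_const q)
        _ ≤ D' * D * ∫⁻ x, F x ^ q ∂Measure.pi (fun _ => μ) := by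
            rw [mul_assoc]
            gcongr

/-- Averages over all coordinates are dominated by a function `G ≥ F` whose weak norm is bounded by the
`L^q` norm. The strong type inequality is iterated over all but one coordinate and the weak type
inequality is used for the last one, so that `q = 1` is allowed for functions of one variable. -/
theorem WeakTypeOne.exists_majorant [∀ n, IsSFiniteKernel (ν n)]
    (hw : WeakTypeOne μ ν C) (hC : C ≠ ∞)
    (hν : ∀ n z, ν n z Set.univ ≤ 1) (hk : 0 < k) (hq1 : 1 ≤ q) (hq : 2 ≤ k → 1 < q) :
    ∃ D : ℝ≥0∞, D ≠ ∞ ∧ ∀ F : (Fin k → E) → ℝ≥0∞, Measurable F →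
      ∃ G : (Fin k → E) → ℝ≥0∞, Measurable G ∧ F ≤ G ∧
        (∀ n x, ∫⁻ u, F u ∂Measure.pi (fun j => ν n (x j)) ≤ G x) ∧
        ∀ t, t * Measure.pi (fun _ => μ) {x | t < G x} ≤
          D * (∫⁻ x, F x ^ q ∂Measure.pi (fun _ => μ)) ^ q⁻¹ := by
  have hq0 : 0 < q := zero_lt_one.trans_le hq1
  have hfin : ∀ n z, IsFiniteMeasure (ν n z) := fun n z =>
    ⟨(hν n z).trans_lt ENNReal.one_lt_top⟩
  let i : Fin k := ⟨0, hk⟩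
  have hs : (Finset.univ.erase i : Finset (Fin k)) = ∅ ∨ 1 < q := by
    rcases Nat.lt_or_ge k 2 with h | h
    · left
      rw [← Finset.card_eq_zero, Finset.card_erase_of_mem (Finset.mem_univ i)]
      simp
      omega
    · exact Or.inr (hq h)
  obtain ⟨D, hD, hmaj⟩ := hw.exists_iterated_majorant hC hν _ hs
  have hlp : ∀ F : (Fin k → E) → ℝ≥0∞, Measurable F → ∫⁻ x, F x ∂Measure.pi (fun _ => μ) ≤
      (∫⁻ x, F x ^ q ∂Measure.pi (fun _ => μ)) ^ q⁻¹ := fun F hF =>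
    (ENNReal.le_rpow_inv_iff hq0).2 (lintegral_rpow_le_lintegral_rpow hF hq1)
  refine ⟨C * D ^ q⁻¹ + 1, by finiteness, fun F hF => ?_⟩
  obtain ⟨G, hG, hFG, hGq⟩ := hmaj F hF
  have hGm := measurable_coordMaximal (ν := ν) i hG
  refine ⟨fun x => max (coordMaximal ν i G x) (F x), hGm.max hF, fun x => le_max_right _ _,
    fun n x => le_trans ?_ (le_max_left _ _), fun t => ?_⟩
  · have h1 : ∫⁻ u, F u ∂Measure.pi (fun j => ν n (x j)) =
        lmarginal (fun j => ν n (x j)) Finset.univ F x := by rw [lmarginal_univ]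
    rw [h1, lmarginal_erase F hF (Finset.mem_univ i)]
    refine le_trans (lintegral_mono fun u => ?_)
      (le_iSup (fun n => ∫⁻ u, G (Function.update x i u) ∂ν n (x i)) n)
    refine le_trans (le_of_eq ?_) (hFG n (Function.update x i u))
    refine congrFun (lmarginal_congr_measure (fun j hj => ?_) F) _
    rw [Function.update_of_ne (Finset.ne_of_mem_erase hj)]
  · have hweak : t * Measure.pi (fun _ => μ) {x | t < coordMaximal ν i G x} ≤
        C * ∫⁻ x, G x ∂Measure.pi (fun _ => μ) := by
      have hms : MeasurableSet {x | t < coordMaximal ν i G x} :=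
        measurableSet_lt measurable_const hGm
      rw [← lintegral_indicator_const hms, ← lintegral_const_mul _ hG]
      refine lintegral_pi_mono_of_update i (measurable_const.indicator hms) (hG.const_mul _)
        fun x => ?_
      have hGx : Measurable fun u => G (Function.update x i u) := hG.comp (measurable_update x)
      have h1 : ∀ u, {x | t < coordMaximal ν i G x}.indicator (fun _ => t)
          (Function.update x i u) =
          {z | t < maximalAverage ν (fun u => G (Function.update x i u)) z}.indicator
            (fun _ => t) u := fun u => by
        simp only [Set.indicator, Set.mem_ofPred_eq, coordMaximal_update]
      simp_rw [h1]
      rw [lintegral_indicator_const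
        (measurableSet_lt measurable_const (measurable_maximalAverage hGx)),
        lintegral_const_mul _ hGx]
      exact hw _ hGx t
    have hF' : t * Measure.pi (fun _ => μ) {x | t < F x} ≤
        ∫⁻ x, F x ∂Measure.pi (fun _ => μ) := by
      refine le_trans ?_ (mul_meas_ge_le_lintegral hF t)
      gcongr with x
      exact fun h => le_of_lt h
    calc t * Measure.pi (fun _ => μ) {x | t < max (coordMaximal ν i G x) (F x)}
        ≤ t * (Measure.pi (fun _ => μ) {x | t < coordMaximal ν i G x} +
            Measure.pi (fun _ => μ) {x | t < F x}) := by
          gcongr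
          refine (measure_mono fun x hx => ?_).trans (measure_union_le _ _)
          exact lt_max_iff.1 (show t < max _ _ from hx)
      _ ≤ C * (D * ∫⁻ x, F x ^ q ∂Measure.pi (fun _ => μ)) ^ q⁻¹ +
            (∫⁻ x, F x ^ q ∂Measure.pi (fun _ => μ)) ^ q⁻¹ := by
          rw [mul_add]
          refine add_le_add (hweak.trans ?_) (hF'.trans (hlp F hF))
          gcongr
          refine (hlp G hG).trans ?_
          gcongr
      _ = (C * D ^ q⁻¹ + 1) * (∫⁻ x, F x ^ q ∂Measure.pi (fun _ => μ)) ^ q⁻¹ := by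
          rw [ENNReal.mul_rpow_of_nonneg _ _ (inv_nonneg.2 hq0.le)]
          ring

end Iterated

/-! ### Pointwise behaviour of kernel averages almost everywhere -/

section Pointwise

/-- Weak type bounds with geometric decay imply convergence almost everywhere, by the
Borel–Cantelli lemma. -/
theorem ae_tendsto_zero_of_weakType {α : Type*} [MeasurableSpace α] {μ : Measure α}
    {G : ℕ → α → ℝ≥0∞} {D : ℝ≥0∞} (hD : D ≠ ∞)
    (h : ∀ l t, t * μ {x | t < G l x} ≤ D * (4⁻¹ : ℝ≥0∞) ^ l) :
    ∀ᵐ x ∂μ, Tendsto (fun l => G l x) atTop (𝓝 0) := by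
  have hb : ∀ l, μ {x | (2⁻¹ : ℝ≥0∞) ^ l < G l x} ≤ D * (2⁻¹ : ℝ≥0∞) ^ l := by
    intro l
    have h2 : (2 : ℝ≥0∞) ^ l * (2⁻¹ : ℝ≥0∞) ^ l = 1 := by
      rw [← mul_pow, ENNReal.mul_inv_cancel (by simp) (by simp), one_pow]
    have h4 : (4⁻¹ : ℝ≥0∞) ^ l = (2⁻¹ : ℝ≥0∞) ^ l * (2⁻¹ : ℝ≥0∞) ^ l := by
      rw [← mul_pow, ← ENNReal.mul_inv (by simp) (by simp)]
      norm_num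
    calc μ {x | (2⁻¹ : ℝ≥0∞) ^ l < G l x}
        = 2 ^ l * ((2⁻¹ : ℝ≥0∞) ^ l * μ {x | (2⁻¹ : ℝ≥0∞) ^ l < G l x}) := by
          rw [← mul_assoc, h2, one_mul]
      _ ≤ 2 ^ l * (D * (4⁻¹ : ℝ≥0∞) ^ l) := mul_le_mul_right (h l _) _
      _ = (2 ^ l * (2⁻¹ : ℝ≥0∞) ^ l) * (D * (2⁻¹ : ℝ≥0∞) ^ l) := by rw [h4]; ring
      _ = D * (2⁻¹ : ℝ≥0∞) ^ l := by rw [h2, one_mul]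
  have hsum : ∑' l, μ {x | (2⁻¹ : ℝ≥0∞) ^ l < G l x} ≠ ∞ := by
    refine ne_top_of_le_ne_top ?_ (ENNReal.tsum_le_tsum hb)
    rw [ENNReal.tsum_mul_left, ENNReal.tsum_geometric]
    exact ENNReal.mul_ne_top hD (by simp)
  filter_upwards [ae_eventually_notMem hsum] with x hx
  refine tendsto_of_tendsto_of_tendsto_of_le_of_le' tendsto_const_nhds
    (ENNReal.tendsto_pow_atTop_nhds_zero_of_lt_one (r := 2⁻¹) (by simp))
    (Eventually.of_forall fun _ => zero_le) ?_
  filter_upwards [hx] with l hl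
  exact not_lt.1 hl

variable {p : ℕ} {μ : Measure (Fin p → ℝ)} [IsProbabilityMeasure μ] {K : (Fin p → ℝ) → ℝ}
  {h : ℕ → ℝ}

/-- Almost everywhere the lower derivative of `μ` with respect to Lebesgue measure is positive, so
the total weight of the kernel is at least of order `hᵖ`. -/
theorem StuteConsistency.ae_kernelMass_ge (hS : StuteConsistency K h) (hpos : ∀ n, 0 < h n) :
    ∀ᵐ z ∂μ, ∃ c > 0, ∀ᶠ n in atTop, ENNReal.ofReal (c * h n ^ p) ≤ kernelMass μ K (h n) z := by
  obtain ⟨C₁, hC₁, C₂, hC₂, hlow⟩ := hS.lower_bound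
  filter_upwards [Besicovitch.ae_tendsto_rnDeriv volume μ,
    (volume : Measure (Fin p → ℝ)).rnDeriv_lt_top μ] with z hz hzfin
  have hr : Tendsto (fun n => C₂ * h n) atTop (𝓝[>] 0) := by
    refine tendsto_nhdsWithin_iff.2 ⟨?_, Eventually.of_forall fun n => mul_pos hC₂ (hpos n)⟩
    simpa using hS.bandwidth_tendsto.const_mul C₂
  have hzr := hz.comp hr
  obtain ⟨M, hM⟩ : ∃ M : ℝ, volume.rnDeriv μ z < ENNReal.ofReal M := by
    refine ⟨(volume.rnDeriv μ z).toReal + 1, ?_⟩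
    rw [ENNReal.lt_ofReal_iff_toReal_lt hzfin.ne]
    linarith
  have hM0 : 0 < M := ENNReal.ofReal_pos.1 (lt_of_le_of_lt zero_le hM)
  refine ⟨C₁ * (2 * C₂) ^ p / M, by positivity, ?_⟩
  filter_upwards [hzr.eventually (gt_mem_nhds hM)] with n hn
  have hrn : 0 < C₂ * h n := mul_pos hC₂ (hpos n)
  have hvol : ENNReal.ofReal ((2 * (C₂ * h n)) ^ p) ≤
      ENNReal.ofReal M * μ (Metric.closedBall z (C₂ * h n)) := by
    have h1 := (ENNReal.div_le_iff_le_mul (Or.inr ENNReal.ofReal_ne_top)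
      (Or.inl (measure_ne_top _ _))).1 (le_of_lt hn)
    rwa [Real.volume_pi_closedBall z hrn.le, Fintype.card_fin] at h1
  have hmass : ENNReal.ofReal C₁ * μ (Metric.closedBall z (C₂ * h n)) ≤
      kernelMass μ K (h n) z := by
    rw [← lintegral_indicator_const Metric.isClosed_closedBall.measurableSet]
    refine lintegral_mono fun u => ?_
    by_cases hu : u ∈ Metric.closedBall z (C₂ * h n)
    · rw [Set.indicator_of_mem hu]
      refine ENNReal.ofReal_le_ofReal ?_
      have h1 := hlow ((h n)⁻¹ • (u - z))
      rwa [Set.indicator_of_mem, mul_one] at h1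
      rw [mem_closedBall_zero_iff, norm_smul, Real.norm_of_nonneg (inv_pos.2 (hpos n)).le,
        ← dist_eq_norm, inv_mul_le_iff₀ (hpos n), mul_comm]
      exact hu
    · rw [Set.indicator_of_notMem hu]
      exact zero_le
  refine le_trans ?_ hmass
  have h1 : C₁ * (2 * C₂) ^ p / M * h n ^ p = C₁ * (M⁻¹ * (2 * (C₂ * h n)) ^ p) := by
    rw [← mul_assoc 2, mul_pow (2 * C₂)]
    field_simp
  rw [h1, ENNReal.ofReal_mul hC₁.le, ENNReal.ofReal_mul (inv_pos.2 hM0).le]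
  gcongr
  calc ENNReal.ofReal M⁻¹ * ENNReal.ofReal ((2 * (C₂ * h n)) ^ p)
      ≤ ENNReal.ofReal M⁻¹ * (ENNReal.ofReal M * μ (Metric.closedBall z (C₂ * h n))) := by gcongr
    _ = μ (Metric.closedBall z (C₂ * h n)) := by
        rw [← mul_assoc, ← ENNReal.ofReal_mul (inv_pos.2 hM0).le, inv_mul_cancel₀ hM0.ne',
          ENNReal.ofReal_one, one_mul]

theorem StuteConsistency.nonneg (hS : StuteConsistency K h) (z : Fin p → ℝ) : 0 ≤ K z := by
  obtain ⟨H, -, hH0, -, c₁, hc₁, c₂, hc₂, hKH⟩ := hS.envelope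
  exact (mul_nonneg hc₁.le (hH0 _ (norm_nonneg z))).trans (hKH z).1

theorem StuteConsistency.exists_le (hS : StuteConsistency K h) : ∃ B, 0 ≤ B ∧ ∀ z, K z ≤ B := by
  obtain ⟨H, hH, hH0, -, c₁, hc₁, c₂, hc₂, hKH⟩ := hS.envelope
  refine ⟨c₂ * H 0, mul_nonneg hc₂.le (hH0 0 le_rfl), fun z => (hKH z).2.trans ?_⟩
  gcongr
  exact hH (Set.mem_Ici.2 le_rfl) (Set.mem_Ici.2 (norm_nonneg z)) (norm_nonneg z)

theorem StuteConsistency.kernelMass_ne_top (hS : StuteConsistency K h) (b : ℝ) (z : Fin p → ℝ) :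
    kernelMass μ K b z ≠ ∞ := by
  obtain ⟨B, -, hB⟩ := hS.exists_le
  refine ne_top_of_le_ne_top (b := ENNReal.ofReal B * μ Set.univ) (by finiteness) ?_
  rw [← lintegral_const]
  exact lintegral_mono fun u => ENNReal.ofReal_le_ofReal (hB _)

theorem averagingKernel_univ (hK : Measurable K) {b : ℝ} {z : Fin p → ℝ}
    (h0 : kernelMass μ K b z ≠ 0) (htop : kernelMass μ K b z ≠ ∞) :
    averagingKernel μ K b z Set.univ = 1 := by
  have h1 := lintegral_averagingKernel (μ := μ) (h := b) hK z (f := 1) measurable_one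
  simp only [Pi.one_apply, lintegral_one, mul_one] at h1
  rw [h1]
  exact ENNReal.div_self h0 htop

/-- The averaging measures concentrate at their centre. -/
theorem StuteConsistency.tendsto_averagingKernel_compl (hS : StuteConsistency K h)
    (hK : Measurable K) (hpos : ∀ n, 0 < h n) {z : Fin p → ℝ} {c : ℝ} (hc : 0 < c)
    (hz : ∀ᶠ n in atTop, ENNReal.ofReal (c * h n ^ p) ≤ kernelMass μ K (h n) z)
    {δ : ℝ} (hδ : 0 < δ) :
    Tendsto (fun n => averagingKernel μ K (h n) z {u | δ ≤ dist u z}) atTop (𝓝 0) := by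
  obtain ⟨H, hH, hH0, hHo, c₁, hc₁, c₂, hc₂, hKH⟩ := hS.envelope
  have hms : MeasurableSet {u : Fin p → ℝ | δ ≤ dist u z} :=
    (isClosed_le continuous_const (continuous_id.dist continuous_const)).measurableSet
  have hinf : Tendsto (fun n => (h n)⁻¹ * δ) atTop atTop := by
    refine Tendsto.atTop_mul_const hδ (tendsto_inv_nhdsGT_zero.comp ?_)
    exact tendsto_nhdsWithin_iff.2 ⟨hS.bandwidth_tendsto, Eventually.of_forall hpos⟩
  have hlim : Tendsto (fun n => ENNReal.ofReal (c₂ / (c * δ ^ p) *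
      (H ((h n)⁻¹ * δ) / (((h n)⁻¹ * δ) ^ p)⁻¹))) atTop (𝓝 0) := by
    have h1 := (hHo.tendsto_div_nhds_zero.comp hinf).const_mul (c₂ / (c * δ ^ p))
    rw [mul_zero] at h1
    simpa using ENNReal.tendsto_ofReal h1
  refine tendsto_of_tendsto_of_tendsto_of_le_of_le' tendsto_const_nhds hlim
    (Eventually.of_forall fun _ => zero_le) ?_
  filter_upwards [hz] with n hn
  have hnum : ∫⁻ u, ENNReal.ofReal (K ((h n)⁻¹ • (u - z))) *
      {u | δ ≤ dist u z}.indicator 1 u ∂μ ≤ ENNReal.ofReal (c₂ * H ((h n)⁻¹ * δ)) := by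
    calc ∫⁻ u, ENNReal.ofReal (K ((h n)⁻¹ • (u - z))) * {u | δ ≤ dist u z}.indicator 1 u ∂μ
        ≤ ∫⁻ _u, ENNReal.ofReal (c₂ * H ((h n)⁻¹ * δ)) ∂μ := by
          refine lintegral_mono fun u => ?_
          by_cases hu : u ∈ {u | δ ≤ dist u z}
          · rw [Set.indicator_of_mem hu, Pi.one_apply, mul_one]
            refine ENNReal.ofReal_le_ofReal ((hKH _).2.trans ?_)
            have hu' : (h n)⁻¹ * δ ≤ (h n)⁻¹ * dist u z :=
              mul_le_mul_of_nonneg_left hu (inv_pos.2 (hpos n)).le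
            have h0 : 0 ≤ (h n)⁻¹ * δ := mul_nonneg (inv_pos.2 (hpos n)).le hδ.le
            rw [norm_smul, Real.norm_of_nonneg (inv_pos.2 (hpos n)).le, ← dist_eq_norm]
            exact mul_le_mul_of_nonneg_left
              (hH (Set.mem_Ici.2 h0) (Set.mem_Ici.2 (h0.trans hu')) hu') hc₂.le
          · rw [Set.indicator_of_notMem hu, mul_zero]
            exact zero_le
      _ = ENNReal.ofReal (c₂ * H ((h n)⁻¹ * δ)) := by simp
  have h1 := lintegral_averagingKernel (μ := μ) (h := h n) hK z
    (f := {u | δ ≤ dist u z}.indicator 1) (measurable_one.indicator hms)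
  rw [lintegral_indicator_one hms] at h1
  rw [h1]
  have hcp : 0 < c * h n ^ p := mul_pos hc (pow_pos (hpos n) p)
  calc _ ≤ ENNReal.ofReal (c₂ * H ((h n)⁻¹ * δ)) / ENNReal.ofReal (c * h n ^ p) :=
        ENNReal.div_le_div hnum hn
    _ = _ := by
        rw [← ENNReal.ofReal_div_of_pos hcp]
        congr 1
        have := (hpos n).ne'
        rw [mul_pow, inv_pow]
        field_simp

/-- Almost every point is a Lebesgue point along the averaging measures: by the concentration of
these measures this holds for continuous functions, and the maximal inequality extends it to
integrable functions. -/
theorem StuteConsistency.ae_tendsto_lintegral_enorm_sub (hS : StuteConsistency K h)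
    (hK : Measurable K) (hpos : ∀ n, 0 < h n) {m : (Fin p → ℝ) → ℝ} (hm : Measurable m)
    (hmi : MemLp m 1 μ) :
    ∀ᵐ z ∂μ, Tendsto (fun n => ∫⁻ u, ‖m u - m z‖ₑ ∂averagingKernel μ K (h n) z) atTop (𝓝 0) := by
  have hS' := hS
  obtain ⟨H, hH, hH0, hHo, c₁, hc₁, c₂, hc₂, hKH⟩ := hS'.envelope
  obtain ⟨C, hC, hw⟩ := exists_weakTypeOne_averagingKernel (μ := μ) hK hpos hH hH0 hc₁ hc₂ hKH
  have happ : ∀ l : ℕ, ∃ φ : BoundedContinuousFunction (Fin p → ℝ) ℝ,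
      eLpNorm (m - ⇑φ) 1 μ ≤ (4⁻¹ : ℝ≥0∞) ^ l := fun l =>
    (hmi.exists_boundedContinuous_eLpNorm_sub_le ENNReal.one_ne_top
      (pow_ne_zero l (by simp))).imp fun φ hφ => hφ.1
  choose φ hφ using happ
  have hfm : ∀ l, Measurable fun u => ‖m u - φ l u‖ₑ := fun l =>
    (hm.sub (φ l).continuous.measurable).enorm
  have hφ' : ∀ l, ∫⁻ u, ‖m u - φ l u‖ₑ ∂μ ≤ (4⁻¹ : ℝ≥0∞) ^ l := fun l => by
    have h1 := hφ l
    rw [eLpNorm_one_eq_lintegral_enorm] at h1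
    exact h1
  have hmax := ae_tendsto_zero_of_weakType (μ := μ)
    (G := fun l => maximalAverage (fun n => averagingKernel μ K (h n)) fun u => ‖m u - φ l u‖ₑ) hC
    fun l t => (hw _ (hfm l) t).trans (by gcongr; exact hφ' l)
  have hself := ae_tendsto_zero_of_weakType (μ := μ) (G := fun l u => ‖m u - φ l u‖ₑ)
    ENNReal.one_ne_top fun l t => by
      rw [one_mul]
      refine le_trans ?_ ((mul_meas_ge_le_lintegral (hfm l) t).trans (hφ' l))
      gcongr with x
      exact fun h => le_of_lt h
  filter_upwards [hmax, hself, hS.ae_kernelMass_ge (μ := μ) hpos] with z hz1 hz2 ⟨c, hc, hz3⟩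
  rw [ENNReal.tendsto_nhds_zero]
  intro ε hε
  obtain ⟨ε', hε', hεε⟩ : ∃ ε' : ℝ, 0 < ε' ∧ ENNReal.ofReal ε' ≤ ε / 3 := by
    obtain ⟨a, ha0, ha⟩ := ENNReal.lt_iff_exists_nnreal_btwn.1
      (ENNReal.div_pos hε.ne' (by simp : (3 : ℝ≥0∞) ≠ ∞))
    refine ⟨a, by exact_mod_cast ha0, ?_⟩
    rw [ENNReal.ofReal_coe_nnreal]
    exact ha.le
  have hε4 : (0 : ℝ≥0∞) < ENNReal.ofReal (ε' / 2) := ENNReal.ofReal_pos.2 (by positivity)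
  obtain ⟨l, hl1, hl2⟩ := ((ENNReal.tendsto_nhds_zero.1 hz1 _ (ENNReal.ofReal_pos.2 hε')).and
    (ENNReal.tendsto_nhds_zero.1 hz2 _ hε4)).exists
  obtain ⟨δ, hδ, hδφ⟩ := Metric.continuousAt_iff.1 ((φ l).continuous.continuousAt (x := z))
    (ε' / 2) (by positivity)
  have htail := (ENNReal.Tendsto.const_mul
    (hS.tendsto_averagingKernel_compl (μ := μ) hK hpos hc hz3 hδ)
    (Or.inr (ENNReal.ofReal_ne_top (r := 2 * ‖φ l‖))))
  rw [mul_zero] at htail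
  filter_upwards [ENNReal.tendsto_nhds_zero.1 htail _ (ENNReal.ofReal_pos.2 hε')] with n hn
  have hu1 : averagingKernel μ K (h n) z Set.univ ≤ 1 := averagingKernel_univ_le hK z
  have hms : MeasurableSet {u : Fin p → ℝ | δ ≤ dist u z} :=
    (isClosed_le continuous_const (continuous_id.dist continuous_const)).measurableSet
  calc ∫⁻ u, ‖m u - m z‖ₑ ∂averagingKernel μ K (h n) z
      ≤ ∫⁻ u, (‖m u - φ l u‖ₑ + {u | δ ≤ dist u z}.indicator
          (fun _ => ENNReal.ofReal (2 * ‖φ l‖)) u) + ENNReal.ofReal ε'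
            ∂averagingKernel μ K (h n) z := by
        refine lintegral_mono fun u => ?_
        have h1 : ‖m u - m z‖ₑ ≤ ‖m u - φ l u‖ₑ + (‖φ l u - φ l z‖ₑ + ‖m z - φ l z‖ₑ) := by
          have : m u - m z = (m u - φ l u) + ((φ l u - φ l z) - (m z - φ l z)) := by ring
          rw [this]
          refine (enorm_add_le _ _).trans ?_
          gcongr
          exact enorm_sub_le
        have h2 : ‖φ l u - φ l z‖ₑ ≤ {u | δ ≤ dist u z}.indicator
            (fun _ => ENNReal.ofReal (2 * ‖φ l‖)) u + ENNReal.ofReal (ε' / 2) := by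
          by_cases hu : u ∈ {u | δ ≤ dist u z}
          · rw [Set.indicator_of_mem hu, ← ofReal_norm, ← dist_eq_norm]
            exact (ENNReal.ofReal_le_ofReal ((φ l).dist_le_two_norm u z)).trans le_self_add
          · rw [Set.indicator_of_notMem hu, zero_add, ← ofReal_norm, ← dist_eq_norm]
            exact ENNReal.ofReal_le_ofReal (hδφ (not_le.1 hu)).le
        calc _ ≤ _ := h1
          _ ≤ ‖m u - φ l u‖ₑ + (({u | δ ≤ dist u z}.indicator
            (fun _ => ENNReal.ofReal (2 * ‖φ l‖)) u + ENNReal.ofReal (ε' / 2)) +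
              ENNReal.ofReal (ε' / 2)) := by gcongr
          _ = _ := by
            rw [add_assoc, add_assoc, ← ENNReal.ofReal_add (by positivity) (by positivity),
              add_halves]
    _ = (∫⁻ u, ‖m u - φ l u‖ₑ ∂averagingKernel μ K (h n) z +
          ENNReal.ofReal (2 * ‖φ l‖) * averagingKernel μ K (h n) z {u | δ ≤ dist u z}) +
          ENNReal.ofReal ε' * averagingKernel μ K (h n) z Set.univ := by
        rw [lintegral_add_right _ measurable_const, lintegral_add_left (hfm l),
          lintegral_indicator_const hms, lintegral_const]
    _ ≤ (ε / 3 + ε / 3) + ε / 3 := by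
        gcongr
        · exact ((le_iSup (fun n => ∫⁻ u, ‖m u - φ l u‖ₑ ∂averagingKernel μ K (h n) z) n).trans
            hl1).trans hεε
        · exact hn.trans hεε
        · exact (mul_le_of_le_one_right' hu1).trans hεε
    _ = ε := ENNReal.add_thirds ε

theorem StuteConsistency.ae_tendsto_lintegral_averagingKernel (hS : StuteConsistency K h)
    (hK : Measurable K) (hpos : ∀ n, 0 < h n) {m : (Fin p → ℝ) → ℝ≥0∞} (hm : Measurable m)
    (hm1 : ∀ z, m z ≤ 1) :
    ∀ᵐ z ∂μ, Tendsto (fun n => ∫⁻ u, m u ∂averagingKernel μ K (h n) z) atTop (𝓝 (m z)) := by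
  have hfin : ∀ z, m z ≠ ∞ := fun z => ne_top_of_le_ne_top ENNReal.one_ne_top (hm1 z)
  have hmi : MemLp (fun z => (m z).toReal) 1 μ := by
    refine MemLp.of_bound hm.ennreal_toReal.aestronglyMeasurable 1 (Eventually.of_forall fun z => ?_)
    rw [Real.norm_of_nonneg ENNReal.toReal_nonneg]
    exact ENNReal.toReal_mono ENNReal.one_ne_top (hm1 z)
  filter_upwards [hS.ae_tendsto_lintegral_enorm_sub hK hpos hm.ennreal_toReal hmi,
    hS.ae_kernelMass_ge (μ := μ) hpos] with z hz ⟨c, hc, hzc⟩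
  have hle : ∀ a b : ℝ≥0∞, a ≠ ∞ → b ≠ ∞ → a ≤ b + ‖a.toReal - b.toReal‖ₑ := by
    intro a b ha hb
    rw [← ENNReal.ofReal_toReal ha, ← ENNReal.ofReal_toReal hb, ENNReal.toReal_ofReal (by simp),
      ENNReal.toReal_ofReal (by simp), ← ofReal_norm,
      ← ENNReal.ofReal_add (by simp) (by simp)]
    refine ENNReal.ofReal_le_ofReal ?_
    have := le_abs_self (a.toReal - b.toReal)
    rw [Real.norm_eq_abs]
    linarith
  have hem : ∀ z, Measurable fun u => ‖(m u).toReal - (m z).toReal‖ₑ := fun z =>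
    (hm.ennreal_toReal.sub_const _).enorm
  have hup := hz.const_add (m z)
  have hlo := ENNReal.Tendsto.sub (tendsto_const_nhds (x := m z)) hz (Or.inl (hfin z))
  rw [add_zero] at hup
  rw [tsub_zero] at hlo
  refine tendsto_of_tendsto_of_tendsto_of_le_of_le' hlo hup ?_ (Eventually.of_forall fun n => ?_)
  · filter_upwards [hzc] with n hn
    have h0 : kernelMass μ K (h n) z ≠ 0 :=
      ((ENNReal.ofReal_pos.2 (mul_pos hc (pow_pos (hpos n) p))).trans_le hn).ne'
    have h1 := averagingKernel_univ hK h0 (hS.kernelMass_ne_top (h n) z)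
    refine tsub_le_iff_right.2 ?_
    rw [← lintegral_add_right _ (hem z)]
    calc m z = ∫⁻ _u, m z ∂averagingKernel μ K (h n) z := by rw [lintegral_const, h1, mul_one]
      _ ≤ _ := lintegral_mono fun u => by
          have := hle (m z) (m u) (hfin z) (hfin u)
          rwa [← enorm_neg, neg_sub] at this
  · calc ∫⁻ u, m u ∂averagingKernel μ K (h n) z
        ≤ ∫⁻ u, m z + ‖(m u).toReal - (m z).toReal‖ₑ ∂averagingKernel μ K (h n) z :=
          lintegral_mono fun u => hle (m u) (m z) (hfin u) (hfin z)
      _ = m z * averagingKernel μ K (h n) z Set.univ +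
            ∫⁻ u, ‖(m u).toReal - (m z).toReal‖ₑ ∂averagingKernel μ K (h n) z := by
          rw [lintegral_add_left measurable_const, lintegral_const]
      _ ≤ _ := by
          gcongr
          exact mul_le_of_le_one_right' (averagingKernel_univ_le hK z)

end Pointwise

/-! ### Density of linear combinations of indicators of rectangles -/

section Density

/-- The linear span of the indicators of measurable rectangles in `𝒳ᵏ`. -/
noncomputable def rectSpan (𝒳 : Type*) [MeasurableSpace 𝒳] (k : ℕ) :
    Submodule ℝ ((Fin k → 𝒳) → ℝ) :=
  Submodule.span ℝ {f | ∃ B : Fin k → Set 𝒳, (∀ i, MeasurableSet (B i)) ∧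
    f = (Set.univ.pi B).indicator 1}

variable {𝒳 : Type*} [MeasurableSpace 𝒳] {k : ℕ}

theorem indicator_pi_mem_rectSpan {B : Fin k → Set 𝒳} (hB : ∀ i, MeasurableSet (B i)) :
    (Set.univ.pi B).indicator 1 ∈ rectSpan 𝒳 k :=
  Submodule.subset_span ⟨B, hB, rfl⟩

theorem rectSpan_measurable_and_bounded {f : (Fin k → 𝒳) → ℝ} (hf : f ∈ rectSpan 𝒳 k) :
    Measurable f ∧ ∃ b, ∀ x, |f x| ≤ b := by
  induction hf using Submodule.span_induction with
  | mem f hf =>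
    obtain ⟨B, hB, rfl⟩ := hf
    refine ⟨measurable_one.indicator (MeasurableSet.univ_pi hB), 1, fun x => ?_⟩
    by_cases hx : x ∈ Set.univ.pi B <;> simp [Set.indicator, hx]
  | zero => exact ⟨measurable_zero, 0, by simp⟩
  | add f g _ _ hf hg =>
    obtain ⟨hf, a, ha⟩ := hf
    obtain ⟨hg, b, hb⟩ := hg
    exact ⟨hf.add hg, a + b, fun x => (abs_add_le _ _).trans (add_le_add (ha x) (hb x))⟩
  | smul c f _ hf =>
    obtain ⟨hf, a, ha⟩ := hf
    refine ⟨hf.const_smul c, |c| * a, fun x => ?_⟩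
    rw [Pi.smul_apply, smul_eq_mul, abs_mul]
    exact mul_le_mul_of_nonneg_left (ha x) (abs_nonneg c)

/-- Approximability in `L^q` by the span of indicators of rectangles. -/
def RectApproximable (ρ : Measure (Fin k → 𝒳)) (q : ℝ≥0∞) (f : (Fin k → 𝒳) → ℝ) : Prop :=
  ∀ ε : ℝ≥0∞, ε ≠ 0 → ∃ f' ∈ rectSpan 𝒳 k, eLpNorm (f' - f) q ρ ≤ ε

variable {ρ : Measure (Fin k → 𝒳)} {q : ℝ≥0∞}

theorem RectApproximable.of_mem {f : (Fin k → 𝒳) → ℝ} (hf : f ∈ rectSpan 𝒳 k) :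
    RectApproximable ρ q f := fun ε _ => ⟨f, hf, by simp⟩

theorem RectApproximable.add (hq : 1 ≤ q) {f g : (Fin k → 𝒳) → ℝ} (hf : RectApproximable ρ q f)
    (hg : RectApproximable ρ q g) (hfm : Measurable f) (hgm : Measurable g) :
    RectApproximable ρ q (f + g) := by
  intro ε hε
  obtain ⟨f', hf', hf'ε⟩ := hf (ε / 2) (ENNReal.half_pos hε).ne'
  obtain ⟨g', hg', hg'ε⟩ := hg (ε / 2) (ENNReal.half_pos hε).ne'
  refine ⟨f' + g', Submodule.add_mem _ hf' hg', ?_⟩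
  rw [add_sub_add_comm]
  refine (eLpNorm_add_le ?_ ?_ hq).trans ((add_le_add hf'ε hg'ε).trans (ENNReal.add_halves ε).le)
  · exact ((rectSpan_measurable_and_bounded hf').1.sub hfm).aestronglyMeasurable
  · exact ((rectSpan_measurable_and_bounded hg').1.sub hgm).aestronglyMeasurable

theorem RectApproximable.const_smul {f : (Fin k → 𝒳) → ℝ} (hf : RectApproximable ρ q f) (c : ℝ) :
    RectApproximable ρ q (c • f) := by
  intro ε hε
  by_cases hc : c = 0
  · exact ⟨0, Submodule.zero_mem _, by simp [hc]⟩
  have hc' : ‖c‖ₑ ≠ 0 := by simpa using hc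
  obtain ⟨f', hf', hf'ε⟩ := hf (ε / ‖c‖ₑ) (ENNReal.div_pos hε (by simp)).ne'
  refine ⟨c • f', Submodule.smul_mem _ c hf', ?_⟩
  rw [← smul_sub, eLpNorm_const_smul]
  calc ‖c‖ₑ * eLpNorm (f' - f) q ρ ≤ ‖c‖ₑ * (ε / ‖c‖ₑ) := by gcongr
    _ = ε := ENNReal.mul_div_cancel hc' (by simp)

/-- Sets with approximable indicator form a Dynkin system that contains the rectangles. -/
theorem rectApproximable_indicator [IsFiniteMeasure ρ] (hq : 1 ≤ q) (hq' : q ≠ ∞)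
    (s : Set (Fin k → 𝒳)) (hs : MeasurableSet s) : RectApproximable ρ q (s.indicator 1) := by
  induction s, hs using MeasurableSpace.induction_on_inter
    (generateFrom_pi (α := fun _ : Fin k => 𝒳)).symm isPiSystem_pi with
  | empty => exact .of_mem (by rw [Set.indicator_empty']; exact Submodule.zero_mem _)
  | basic t ht =>
    obtain ⟨B, hB, rfl⟩ := ht
    exact .of_mem (indicator_pi_mem_rectSpan fun i => hB i (Set.mem_univ i))
  | compl t htm ih =>
    have h1 : (tᶜ.indicator 1 : (Fin k → 𝒳) → ℝ) = 1 + (-1 : ℝ) • t.indicator 1 := by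
      rw [Set.indicator_compl]
      simp [sub_eq_add_neg]
    have h2 : RectApproximable ρ q (1 : (Fin k → 𝒳) → ℝ) := by
      have := indicator_pi_mem_rectSpan (𝒳 := 𝒳) (k := k) (B := fun _ => Set.univ)
        fun _ => MeasurableSet.univ
      rw [Set.pi_univ, Set.indicator_univ] at this
      exact .of_mem this
    rw [h1]
    exact h2.add hq (ih.const_smul _) measurable_one
      ((measurable_one.indicator htm).const_smul _)
  | iUnion f hd hfm ih =>
    have hpart : ∀ n, RectApproximable ρ q ((⋃ i ∈ Finset.range n, f i).indicator 1) ∧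
        MeasurableSet (⋃ i ∈ Finset.range n, f i) := by
      intro n
      refine ⟨?_, Finset.measurableSet_biUnion _ fun i _ => hfm i⟩
      induction n with
      | zero =>
        have h0 : (⋃ i ∈ Finset.range 0, f i) = ∅ := by simp
        rw [h0, Set.indicator_empty']
        exact .of_mem (Submodule.zero_mem _)
      | succ n ihn =>
        have hm : MeasurableSet (⋃ i ∈ Finset.range n, f i) :=
          Finset.measurableSet_biUnion _ fun i _ => hfm i
        rw [Finset.range_add_one, Finset.set_biUnion_insert, Set.indicator_union_of_disjoint]
        · exact (ih n).add hq ihn (measurable_one.indicator (hfm n)) (measurable_one.indicator hm)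
        · rw [Set.disjoint_iUnion₂_right]
          intro i hi
          exact hd (Finset.mem_range.1 hi).ne'
    have htail : Tendsto (fun n => ρ ((⋃ i, f i) \ ⋃ i ∈ Finset.range n, f i)) atTop (𝓝 0) := by
      have h1 := tendsto_measure_iInter_atTop (μ := ρ)
        (s := fun n => (⋃ i, f i) \ ⋃ i ∈ Finset.range n, f i)
        (fun n => ((MeasurableSet.iUnion hfm).diff (hpart n).2).nullMeasurableSet)
        (fun m n hmn => Set.sdiff_subset_sdiff_right
          (Set.biUnion_subset_biUnion_left fun i hi => by
            simp only [Finset.coe_range] at hi ⊢; exact hi.trans_le hmn))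
        ⟨0, measure_ne_top _ _⟩
      have h2 : ⋂ n, (⋃ i, f i) \ ⋃ i ∈ Finset.range n, f i = ∅ := by
        ext x
        simp only [Set.mem_iInter, Set.mem_sdiff, Set.mem_iUnion, Finset.mem_range,
          Set.mem_empty_iff_false, iff_false, not_forall]
        by_cases hx : ∃ i, x ∈ f i
        · obtain ⟨i, hi⟩ := hx
          exact ⟨i + 1, fun h => h.2 ⟨i, Nat.lt_succ_self i, hi⟩⟩
        · exact ⟨0, fun h => hx h.1⟩
      rw [h2, measure_empty] at h1
      exact h1
    have hq0 : 0 < q.toReal := ENNReal.toReal_pos (zero_lt_one.trans_le hq).ne' hq'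
    intro ε hε
    have hpow := (ENNReal.continuous_rpow_const (y := 1 / q.toReal)).tendsto 0 |>.comp htail
    rw [ENNReal.zero_rpow_of_pos (by positivity)] at hpow
    obtain ⟨n, hn⟩ := (ENNReal.tendsto_nhds_zero.1 hpow (ε / 2) (ENNReal.half_pos hε)).exists
    obtain ⟨f', hf', hf'ε⟩ := (hpart n).1 (ε / 2) (ENNReal.half_pos hε).ne'
    refine ⟨f', hf', ?_⟩
    have h1 : f' - (⋃ i, f i).indicator 1 = (f' - (⋃ i ∈ Finset.range n, f i).indicator 1) -
        ((⋃ i, f i) \ ⋃ i ∈ Finset.range n, f i).indicator (fun _ => (1 : ℝ)) := by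
      rw [Set.indicator_sdiff (Set.iUnion₂_subset fun i _ => Set.subset_iUnion f i)]
      simp only [Pi.one_def]
      abel
    have hm : MeasurableSet ((⋃ i, f i) \ ⋃ i ∈ Finset.range n, f i) :=
      (MeasurableSet.iUnion hfm).diff (hpart n).2
    rw [h1]
    refine (eLpNorm_sub_le ?_ ?_ hq).trans ((add_le_add hf'ε ?_).trans (ENNReal.add_halves ε).le)
    · exact ((rectSpan_measurable_and_bounded hf').1.sub
        (measurable_one.indicator (hpart n).2)).aestronglyMeasurable
    · exact (measurable_const.indicator hm).aestronglyMeasurable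
    · rw [eLpNorm_indicator_const hm (zero_lt_one.trans_le hq).ne' hq']
      simpa using hn

/-- Linear combinations of indicators of rectangles are dense in `L^q`, `q < ∞`. -/
theorem MeasureTheory.MemLp.exists_rectSpan_eLpNorm_sub_le [IsFiniteMeasure ρ] (hq : 1 ≤ q)
    (hq' : q ≠ ∞) {g : (Fin k → 𝒳) → ℝ} (hg : MemLp g q ρ) {ε : ℝ≥0∞} (hε : ε ≠ 0) :
    ∃ f ∈ rectSpan 𝒳 k, eLpNorm (g - f) q ρ ≤ ε := by
  obtain ⟨f, hfε, hf⟩ := hg.induction_dense hq' (P := fun f => f ∈ rectSpan 𝒳 k)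
    (fun c s hs _ ε hε => by
      obtain ⟨f', hf', h⟩ := (rectApproximable_indicator (ρ := ρ) hq hq' s hs).const_smul c ε hε
      refine ⟨f', ?_, hf'⟩
      convert! h using 2
      ext x
      by_cases hx : x ∈ s <;> simp [hx])
    (fun f g hf hg => Submodule.add_mem _ hf hg)
    (fun f hf => (rectSpan_measurable_and_bounded hf).1.aestronglyMeasurable) hε
  exact ⟨f, hf, hfε⟩

end Density

/-! ### Product measures and product kernels -/

section ProductKernel

variable {E 𝒳 : Type*} [MeasurableSpace E] [MeasurableSpace 𝒳] {k : ℕ}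

theorem lintegral_pi_prod {μ : Fin k → Measure E} [∀ i, IsProbabilityMeasure (μ i)]
    {f : Fin k → E → ℝ≥0∞} (hf : ∀ i, Measurable (f i)) :
    ∫⁻ u, ∏ i, f i (u i) ∂Measure.pi μ = ∏ i, ∫⁻ u, f i u ∂μ i := by
  refine (lintegral_prod_eq_prod_lintegral_of_indepFun Finset.univ
    (fun i (u : Fin k → E) => f i (u i))
    (iIndepFun_pi fun i => (hf i).aemeasurable)
    fun i => (hf i).comp (measurable_pi_apply i)).trans ?_
  exact Finset.prod_congr rfl fun i _ => (measurePreserving_eval μ i).lintegral_comp (hf i)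

/-- The kernel that sends `(z₁, …, z_k)` to the product of the measures `κ z₁, …, κ z_k`. -/
noncomputable def piKernel (κ : Kernel E 𝒳) [IsMarkovKernel κ] (k : ℕ) :
    Kernel (Fin k → E) (Fin k → 𝒳) where
  toFun u := Measure.pi fun i => κ (u i)
  measurable' := by
    refine Measurable.measure_of_isPiSystem_of_isProbabilityMeasure
      (generateFrom_pi (α := fun _ : Fin k => 𝒳)).symm isPiSystem_pi ?_
    rintro _ ⟨B, hB, rfl⟩
    simp only [Measure.pi_pi]
    exact Finset.measurable_prod _ fun i _ =>
      (κ.measurable_coe (hB i (Set.mem_univ i))).comp (measurable_pi_apply i)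

variable {κ : Kernel E 𝒳} [IsMarkovKernel κ]

theorem piKernel_apply (u : Fin k → E) : piKernel κ k u = Measure.pi fun i => κ (u i) := rfl

instance : IsMarkovKernel (piKernel κ k) := ⟨fun u => by rw [piKernel_apply]; infer_instance⟩

variable {μ : Measure E} [IsProbabilityMeasure μ]

/-- A product of joint laws is disintegrated by the product kernel. -/
theorem pi_compProd : Measure.pi (fun _ : Fin k => μ ⊗ₘ κ) =
    ((Measure.pi fun _ : Fin k => μ) ⊗ₘ piKernel κ k).map (fun a i => (a.1 i, a.2 i)) := by
  have hm : Measurable fun (a : (Fin k → E) × (Fin k → 𝒳)) (i : Fin k) => (a.1 i, a.2 i) := by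
    fun_prop
  refine Measure.pi_eq fun s hs => ?_
  have hs' := MeasurableSet.univ_pi hs
  rw [Measure.map_apply hm hs', Measure.compProd_apply (hm hs')]
  have h1 : ∀ u : Fin k → E, piKernel κ k u (Prod.mk u ⁻¹' ((fun a i => (a.1 i, a.2 i)) ⁻¹'
      Set.univ.pi s)) = ∏ i, κ (u i) (Prod.mk (u i) ⁻¹' s i) := by
    intro u
    rw [piKernel_apply, ← Measure.pi_pi]
    rfl
  simp_rw [h1]
  rw [lintegral_pi_prod (μ := fun _ => μ) (f := fun i u => κ u (Prod.mk u ⁻¹' s i))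
    fun i => Kernel.measurable_kernel_prodMk_left (hs i)]
  exact Finset.prod_congr rfl fun i _ => (Measure.compProd_apply (hs i)).symm

theorem lintegral_pi_compProd {Φ : (Fin k → E × 𝒳) → ℝ≥0∞} (hΦ : Measurable Φ) :
    ∫⁻ y, Φ y ∂Measure.pi (fun _ : Fin k => μ ⊗ₘ κ) =
      ∫⁻ u, ∫⁻ x, Φ (fun i => (u i, x i)) ∂piKernel κ k u ∂Measure.pi (fun _ : Fin k => μ) := by
  have hm : Measurable fun (a : (Fin k → E) × (Fin k → 𝒳)) (i : Fin k) => (a.1 i, a.2 i) := by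
    fun_prop
  rw [pi_compProd, lintegral_map hΦ hm]
  exact Measure.lintegral_compProd (hΦ.comp hm)

theorem lintegral_pi_comp {Φ : (Fin k → 𝒳) → ℝ≥0∞} (hΦ : Measurable Φ) :
    ∫⁻ x, Φ x ∂Measure.pi (fun _ : Fin k => κ ∘ₘ μ) =
      ∫⁻ u, ∫⁻ x, Φ x ∂piKernel κ k u ∂Measure.pi (fun _ : Fin k => μ) := by
  have h1 : Measure.pi (fun _ : Fin k => κ ∘ₘ μ) =
      (Measure.pi (fun _ : Fin k => μ ⊗ₘ κ)).map (fun y i => (y i).2) := by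
    have : (κ ∘ₘ μ) = (μ ⊗ₘ κ).map Prod.snd := by
      rw [← Measure.snd_compProd, Measure.snd]
    rw [this]
    have hp : IsProbabilityMeasure ((μ ⊗ₘ κ).map Prod.snd) :=
      Measure.isProbabilityMeasure_map measurable_snd.aemeasurable
    rw [Measure.pi_map_pi (μ := fun _ : Fin k => μ ⊗ₘ κ) (f := fun _ => Prod.snd)
      fun _ => measurable_snd.aemeasurable]
  have hm : Measurable fun (y : Fin k → E × 𝒳) (i : Fin k) => (y i).2 := by fun_prop
  rw [h1, lintegral_map hΦ hm]
  exact lintegral_pi_compProd (hΦ.comp hm)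

/-- A product of measures with densities has the product of the densities as its density. -/
theorem lintegral_pi_withDensity {w : Fin k → E → ℝ≥0∞} (hw : ∀ i, Measurable (w i))
    (hfin : ∀ i, IsFiniteMeasure (μ.withDensity (w i))) {F : (Fin k → E) → ℝ≥0∞}
    (hF : Measurable F) :
    ∫⁻ u, F u ∂Measure.pi (fun i => μ.withDensity (w i)) =
      ∫⁻ u, (∏ i, w i (u i)) * F u ∂Measure.pi (fun _ => μ) := by
  have hwm : Measurable fun u : Fin k → E => ∏ i, w i (u i) :=
    Finset.measurable_prod _ fun i _ => (hw i).comp (measurable_pi_apply i)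
  have h1 : Measure.pi (fun i => μ.withDensity (w i)) =
      (Measure.pi fun _ : Fin k => μ).withDensity fun u => ∏ i, w i (u i) := by
    refine Measure.pi_eq fun s hs => ?_
    rw [withDensity_apply _ (MeasurableSet.univ_pi hs),
      ← lintegral_indicator (MeasurableSet.univ_pi hs)]
    have h2 : ∀ u : Fin k → E, (Set.univ.pi s).indicator (fun u => ∏ i, w i (u i)) u =
        ∏ i, (s i).indicator (w i) (u i) := by
      intro u
      by_cases hu : u ∈ Set.univ.pi s
      · rw [Set.indicator_of_mem hu]
        exact Finset.prod_congr rfl fun i _ =>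
          (Set.indicator_of_mem (hu i (Set.mem_univ i)) _).symm
      · rw [Set.indicator_of_notMem hu]
        obtain ⟨i, hi⟩ : ∃ i, u i ∉ s i := by simpa [Set.mem_pi] using hu
        exact (Finset.prod_eq_zero (Finset.mem_univ i) (Set.indicator_of_notMem hi _)).symm
    simp_rw [h2]
    rw [lintegral_pi_prod (μ := fun _ => μ) (f := fun i => (s i).indicator (w i))
      fun i => (hw i).indicator (hs i)]
    refine Finset.prod_congr rfl fun i _ => ?_
    rw [withDensity_apply _ (hs i), lintegral_indicator (hs i)]
  rw [h1, lintegral_withDensity_eq_lintegral_mul _ hwm hF]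
  rfl

end ProductKernel

/-! ### Sums over injective maps -/

section InjectiveSums

variable {k n : ℕ} {Y : Fin k → Fin n → ℝ} {b : Fin k → ℝ}

/-- On maps with `σ j = σ j'` the factor at `j` is bounded by its maximum, and the remaining
coordinates are free. -/
theorem sum_coincident_le (hY : ∀ j i, 0 ≤ Y j i) (hb : ∀ j i, Y j i ≤ b j) {j j' : Fin k}
    (hj : j' ≠ j) :
    ∑ σ : Fin k → Fin n, (if σ j = σ j' then ∏ l, Y l (σ l) else 0) ≤
      b j * ∏ l : {l // l ≠ j}, ∑ i, Y l i := by
  rw [← (Equiv.funSplitAt j (Fin n)).symm.sum_comp, Fintype.sum_prod_type_right,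
    Finset.prod_univ_sum, Fintype.piFinset_univ, Finset.mul_sum]
  refine Finset.sum_le_sum fun τ _ => ?_
  have h1 : ∀ a : Fin n, ((Equiv.funSplitAt j (Fin n)).symm (a, τ)) j = a := fun a => by simp
  have h2 : ∀ (a : Fin n) (l : {l // l ≠ j}),
      ((Equiv.funSplitAt j (Fin n)).symm (a, τ)) l = τ l := fun a l => by simp [l.2]
  have h3 : ∀ a : Fin n, ((Equiv.funSplitAt j (Fin n)).symm (a, τ)) j' = τ ⟨j', hj⟩ :=
    fun a => h2 a ⟨j', hj⟩
  simp_rw [Fintype.prod_eq_mul_prod_subtype_ne _ j, h1, h2, h3]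
  rw [Finset.sum_ite_eq']
  simp only [Finset.mem_univ, if_true]
  exact mul_le_mul_of_nonneg_right (hb _ _) (Finset.prod_nonneg fun l _ => hY _ _)

theorem sum_embedding_eq_sum_filter (f : (Fin k → Fin n) → ℝ) :
    ∑ σ : Fin k ↪ Fin n, f σ = ∑ σ with Function.Injective σ, f σ := by
  rw [Finset.sum_filter, ← Finset.sum_filter, Finset.sum_subtype (p := Function.Injective) _
    (by simp), ← (Equiv.subtypeInjectiveEquivEmbedding (Fin k) (Fin n)).sum_comp]
  rfl

/-- The sum over all maps factorizes; the maps that are not injective are controlled by the size of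
the largest weight. -/
theorem abs_sum_embedding_sub_prod_le (hY : ∀ j i, 0 ≤ Y j i) (hb : ∀ j i, Y j i ≤ b j) :
    |∑ σ : Fin k ↪ Fin n, ∏ l, Y l (σ l) - ∏ l, ∑ i, Y l i| ≤
      ∑ jj ∈ (Finset.univ : Finset (Fin k)).offDiag,
        b jj.1 * ∏ l : {l // l ≠ jj.1}, ∑ i, Y l i := by
  have hprod : ∀ σ : Fin k → Fin n, 0 ≤ ∏ l, Y l (σ l) := fun σ =>
    Finset.prod_nonneg fun l _ => hY _ _
  have h1 : ∏ l, ∑ i, Y l i = ∑ σ : Fin k → Fin n, ∏ l, Y l (σ l) := by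
    rw [Finset.prod_univ_sum, Fintype.piFinset_univ]
  rw [h1, sum_embedding_eq_sum_filter fun σ => ∏ l, Y l (σ l),
    ← Finset.sum_filter_add_sum_filter_not Finset.univ (fun σ : Fin k → Fin n =>
      Function.Injective σ) fun σ => ∏ l, Y l (σ l), sub_add_cancel_left, abs_neg,
    abs_of_nonneg (Finset.sum_nonneg fun σ _ => hprod σ), Finset.sum_filter]
  calc ∑ σ : Fin k → Fin n, (if ¬ Function.Injective σ then ∏ l, Y l (σ l) else 0)
      ≤ ∑ σ : Fin k → Fin n, ∑ jj ∈ (Finset.univ : Finset (Fin k)).offDiag,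
          (if σ jj.1 = σ jj.2 then ∏ l, Y l (σ l) else 0) := by
        refine Finset.sum_le_sum fun σ _ => ?_
        have hnn : ∀ jj ∈ (Finset.univ : Finset (Fin k)).offDiag,
            0 ≤ (if σ jj.1 = σ jj.2 then ∏ l, Y l (σ l) else 0) := fun jj _ => by
          split_ifs
          exacts [hprod σ, le_rfl]
        split_ifs with h
        · exact Finset.sum_nonneg hnn
        · simp only [Function.Injective, not_forall] at h
          obtain ⟨j, j', hσ, hne⟩ := h
          have := Finset.single_le_sum hnn
            (show (j, j') ∈ (Finset.univ : Finset (Fin k)).offDiag by simp [hne])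
          simpa [hσ] using this
    _ ≤ _ := by
        rw [Finset.sum_comm]
        refine Finset.sum_le_sum fun jj hjj => sum_coincident_le hY hb ?_
        exact (Finset.mem_offDiag.1 hjj).2.2.symm

end InjectiveSums

/-! ### Weighted sums of independent observations -/

section WeightedSums

variable {Ω : Type*} [MeasurableSpace Ω] {P : Measure Ω}

/-- Chebyshev's inequality for sums of bounded nonnegative functions of i.i.d. elements; the variance
of a summand is at most its bound times its mean. -/
theorem meas_abs_sum_sub_ge_le [IsProbabilityMeasure P] {α : Type*} [MeasurableSpace α]
    {T : ℕ → Ω → α}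
    (hT : ∀ i, Measurable (T i)) (hindep : iIndepFun T P)
    (hident : ∀ i, IdentDistrib (T i) (T 0) P P) {f : α → ℝ} (hf : Measurable f) {b : ℝ}
    (hf0 : ∀ a, 0 ≤ f a) (hfb : ∀ a, f a ≤ b) (n : ℕ) {t : ℝ} (ht : 0 < t) :
    P {ω | t ≤ |∑ i : Fin n, f (T i ω) - n * ∫ ω, f (T 0 ω) ∂P|} ≤
      ENNReal.ofReal (n * (b * ∫ ω, f (T 0 ω) ∂P) / t ^ 2) := by
  have hmem : ∀ i, MemLp (fun ω => f (T i ω)) 2 P := fun i =>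
    MemLp.of_bound (hf.comp (hT i)).aestronglyMeasurable b (Eventually.of_forall fun ω => by
      rw [Real.norm_of_nonneg (hf0 _)]; exact hfb _)
  have hint : ∀ i, ∫ ω, f (T i ω) ∂P = ∫ ω, f (T 0 ω) ∂P := fun i =>
    ((hident i).comp hf).integral_eq
  have hvar : ∀ i, variance (fun ω => f (T i ω)) P ≤ b * ∫ ω, f (T 0 ω) ∂P := by
    intro i
    refine (variance_le_expectation_sq (hf.comp (hT i)).aestronglyMeasurable).trans ?_
    rw [← hint i, ← integral_const_mul]
    refine integral_mono ((hmem i).integrable_sq)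
      (((hmem i).integrable one_le_two).const_mul b) fun ω => ?_
    simp only [Pi.pow_apply, sq]
    exact mul_le_mul_of_nonneg_right (hfb _) (hf0 _)
  have hsumeq : ∀ ω, (∑ i : Fin n, fun ω => f (T i ω)) ω = ∑ i : Fin n, f (T i ω) := fun ω => by
    simp
  have hmean : ∫ ω, (∑ i : Fin n, fun ω => f (T i ω)) ω ∂P = n * ∫ ω, f (T 0 ω) ∂P := by
    simp_rw [hsumeq]
    rw [integral_finsetSum (f := fun (i : Fin n) ω => f (T i ω)) _
      fun i _ => (hmem i).integrable one_le_two]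
    simp [hint]
  have hcheb := meas_ge_le_variance_div_sq (μ := P)
    (memLp_finsetSum' (Finset.univ : Finset (Fin n)) fun i _ => hmem i) ht
  rw [hmean, IndepFun.variance_sum (X := fun (i : Fin n) ω => f (T i ω)) (fun i _ => hmem i) fun i _ j _ hij =>
    (hindep.indepFun (fun h => hij (Fin.ext h))).comp hf hf] at hcheb
  simp_rw [hsumeq] at hcheb
  refine hcheb.trans (ENNReal.ofReal_le_ofReal ?_)
  gcongr
  calc ∑ i : Fin n, variance (fun ω => f (T i ω)) P
      ≤ ∑ _i : Fin n, b * ∫ ω, f (T 0 ω) ∂P := Finset.sum_le_sum fun i _ => hvar i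
    _ = n * (b * ∫ ω, f (T 0 ω) ∂P) := by simp

/-- Convergence in probability to a constant passes to the limit under approximation in mean. -/
theorem tendsto_inProbability_of_approx {V : ℕ → Ω → ℝ} {U : ℕ → ℕ → Ω → ℝ} {θ : ℕ → ℝ} {θ₀ : ℝ}
    {G : ℕ → ℝ≥0∞} (hmeas : ∀ m n, AEMeasurable (fun ω => V n ω - U m n ω) P)
    (hU : ∀ m, Tendsto (fun a : ℕ × Ω => U m a.1 a.2) (inProbability P) (𝓝 (θ m)))
    (hVU : ∀ m, ∀ᶠ n in atTop, ∫⁻ ω, ‖V n ω - U m n ω‖ₑ ∂P ≤ G m)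
    (hG : Tendsto G atTop (𝓝 0)) (hθ : Tendsto θ atTop (𝓝 θ₀)) :
    Tendsto (fun a : ℕ × Ω => V a.1 a.2) (inProbability P) (𝓝 θ₀) := by
  rw [Metric.tendsto_nhds]
  intro ε hε
  rw [Filter.Eventually, mem_inProbability, ENNReal.tendsto_nhds_zero]
  intro η hη
  have hε3 : 0 < ENNReal.ofReal (ε / 3) := ENNReal.ofReal_pos.2 (by positivity)
  have hG' := ENNReal.Tendsto.div_const hG (Or.inr hε3.ne')
  rw [ENNReal.zero_div] at hG'
  obtain ⟨m, hm1, hm2⟩ := ((ENNReal.tendsto_nhds_zero.1 hG' (η / 2) (ENNReal.half_pos hη.ne')).and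
    (Metric.tendsto_nhds.1 hθ (ε / 3) (by positivity))).exists
  have hU' := Metric.tendsto_nhds.1 (hU m) (ε / 3) (by positivity)
  rw [Filter.Eventually, mem_inProbability, ENNReal.tendsto_nhds_zero] at hU'
  filter_upwards [hU' (η / 2) (ENNReal.half_pos hη.ne'), hVU m] with n hn1 hn2
  have hmarkov := (meas_ge_le_lintegral_div (hmeas m n).enorm hε3.ne' ENNReal.ofReal_ne_top).trans
    ((ENNReal.div_le_div_right hn2 _).trans hm1)
  refine le_trans ?_ ((add_le_add hn1 hmarkov).trans (ENNReal.add_halves η).le)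
  refine (measure_mono fun ω hω => ?_).trans (measure_union_le _ _)
  by_contra hcon
  simp only [Set.mem_union, Set.mem_ofPred_eq, not_or, not_not, not_le] at hcon hω
  obtain ⟨h1, h2⟩ := hcon
  rw [← ofReal_norm, ENNReal.ofReal_lt_ofReal_iff (by positivity)] at h2
  refine hω ?_
  rw [Real.dist_eq] at h1 hm2 ⊢
  rw [Real.norm_eq_abs] at h2
  calc |V n ω - θ₀| = |(V n ω - U m n ω) + (U m n ω - θ m) + (θ m - θ₀)| := by ring_nf
    _ ≤ |V n ω - U m n ω| + |U m n ω - θ m| + |θ m - θ₀| := abs_add_three _ _ _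
    _ < ε := by linarith

end WeightedSums

/-! ### Consistency of the conditional U-statistic -/

section UStatistic

/-- The numerator of the conditional U-statistic, with the kernel weights divided by their
asymptotic totals `n ∫ K((u - z_j) / h) dμ(u)`. -/
noncomputable def normalizedUStat {𝒳 : Type*} {p k : ℕ} (μ : Measure (Fin p → ℝ))
    (K : (Fin p → ℝ) → ℝ) (h : ℝ) (f : (Fin k → 𝒳) → ℝ) (n : ℕ) (x : ℕ → 𝒳) (ζ : ℕ → Fin p → ℝ)
    (z : Fin k → Fin p → ℝ) : ℝ :=
  ∑ σ : Fin k ↪ Fin n, (∏ j, K (h⁻¹ • (ζ (σ j) - z j)) /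
    (n * (kernelMass μ K h (z j)).toReal)) * f fun j => x (σ j)

variable {Ω 𝒳 : Type*} [MeasurableSpace Ω] [MeasurableSpace 𝒳] {P : Measure Ω}
  [IsProbabilityMeasure P] {p k : ℕ} {X : ℕ → Ω → 𝒳} {Z : ℕ → Ω → Fin p → ℝ}
  {μ : Measure (Fin p → ℝ)} [IsProbabilityMeasure μ]
  {κ : Kernel (Fin p → ℝ) 𝒳} [IsMarkovKernel κ] {K : (Fin p → ℝ) → ℝ} {h : ℕ → ℝ}

omit [MeasurableSpace 𝒳] [IsProbabilityMeasure μ] in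
/-- The normalizing constants cancel in the quotient. -/
theorem condUStat_eq_div {b : ℝ} (hb : 0 < b) {n : ℕ} (hn : n ≠ 0) {z : Fin k → Fin p → ℝ}
    (hz : ∀ j, (kernelMass μ K b (z j)).toReal ≠ 0) (g : (Fin k → 𝒳) → ℝ) (x : ℕ → 𝒳)
    (ζ : ℕ → Fin p → ℝ) :
    condUStat K b g n x ζ z =
      normalizedUStat μ K b g n x ζ z / normalizedUStat μ K b 1 n x ζ z := by
  let s : ℝ := ∏ j, (b ^ p)⁻¹ * (n * (kernelMass μ K b (z j)).toReal)
  have hs : s ≠ 0 := Finset.prod_ne_zero_iff.2 fun j _ =>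
    mul_ne_zero (inv_ne_zero (pow_ne_zero p hb.ne')) (mul_ne_zero (Nat.cast_ne_zero.2 hn) (hz j))
  have hw : ∀ σ : Fin k ↪ Fin n, ∏ j, scaledKernel K b (ζ (σ j) - z j) =
      s * ∏ j, K (b⁻¹ • (ζ (σ j) - z j)) / (n * (kernelMass μ K b (z j)).toReal) := by
    intro σ
    rw [← Finset.prod_mul_distrib]
    refine Finset.prod_congr rfl fun j _ => ?_
    have h1 : (n : ℝ) * (kernelMass μ K b (z j)).toReal ≠ 0 :=
      mul_ne_zero (Nat.cast_ne_zero.2 hn) (hz j)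
    rw [scaledKernel, mul_assoc, mul_div_cancel₀ _ h1]
  have h1 : (∑ σ : Fin k ↪ Fin n, (∏ i, scaledKernel K b (ζ (σ i) - z i)) *
      g (fun i => x (σ i))) = s * normalizedUStat μ K b g n x ζ z := by
    simp only [normalizedUStat, hw, Finset.mul_sum, mul_assoc]
  have h2 : (∑ σ : Fin k ↪ Fin n, ∏ i, scaledKernel K b (ζ (σ i) - z i)) =
      s * normalizedUStat μ K b 1 n x ζ z := by
    simp only [normalizedUStat, hw, Finset.mul_sum, Pi.one_apply, mul_one]
  rw [condUStat, h1, h2, mul_div_mul_left _ _ hs]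

theorem StuteConsistency.tendsto_mul_kernelMass (hS : StuteConsistency K h) {z : Fin p → ℝ} {c : ℝ}
    (hc : 0 < c)
    (hz : ∀ᶠ n in atTop, ENNReal.ofReal (c * h n ^ p) ≤ kernelMass μ K (h n) z) :
    Tendsto (fun n : ℕ => (n : ℝ) * (kernelMass μ K (h n) z).toReal) atTop atTop := by
  refine tendsto_atTop_mono' _ ?_ (hS.effective_size_tendsto.const_mul_atTop hc)
  filter_upwards [hz] with n hn
  have h1 : c * h n ^ p ≤ (kernelMass μ K (h n) z).toReal :=
    (ENNReal.ofReal_le_iff_le_toReal (hS.kernelMass_ne_top _ _)).1 hn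
  calc c * (n * h n ^ p) = n * (c * h n ^ p) := by ring
    _ ≤ n * (kernelMass μ K (h n) z).toReal := by gcongr

/-- The normalized local average of the indicator of `B` around `z` converges in probability to the
conditional probability of `B`: its mean converges at almost every `z`, and its variance is at most
of the order of the inverse of `n ∫ K((u - z) / h) dμ(u)`. -/
theorem StuteConsistency.tendsto_localAverage (hS : StuteConsistency K h) (hK : Measurable K)
    (hX : ∀ i, Measurable (X i)) (hZ : ∀ i, Measurable (Z i))
    (hindep : iIndepFun (fun i ω => (Z i ω, X i ω)) P)
    (hident : ∀ i, IdentDistrib (fun ω => (Z i ω, X i ω)) (fun ω => (Z 0 ω, X 0 ω)) P P)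
    (hlaw : P.map (fun ω => (Z 0 ω, X 0 ω)) = μ ⊗ₘ κ)
    {B : Set 𝒳} (hB : MeasurableSet B) {z : Fin p → ℝ} {c : ℝ} (hc : 0 < c)
    (hz : ∀ᶠ n in atTop, ENNReal.ofReal (c * h n ^ p) ≤ kernelMass μ K (h n) z)
    (hzB : Tendsto (fun n => ∫⁻ u, κ u B ∂averagingKernel μ K (h n) z) atTop (𝓝 (κ z B))) :
    Tendsto (fun a : ℕ × Ω => ∑ i : Fin a.1, K ((h a.1)⁻¹ • (Z i a.2 - z)) /
      (a.1 * (kernelMass μ K (h a.1) z).toReal) * B.indicator 1 (X i a.2))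
      (inProbability P) (𝓝 (κ z B).toReal) := by
  obtain ⟨b, hb0, hb⟩ := hS.exists_le
  have hκB : Measurable fun u => κ u B := κ.measurable_coe hB
  -- The mean of the local average.
  let m : ℕ → ℝ := fun n => (∫⁻ u, κ u B ∂averagingKernel μ K (h n) z).toReal
  have hm : Tendsto m atTop (𝓝 (κ z B).toReal) :=
    (ENNReal.tendsto_toReal (measure_ne_top _ _)).comp hzB
  have hM := hS.tendsto_mul_kernelMass (μ := μ) hc hz
  let f : ℕ → (Fin p → ℝ) × 𝒳 → ℝ := fun n y => K ((h n)⁻¹ • (y.1 - z)) * B.indicator 1 y.2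
  have hind : Measurable (B.indicator (1 : 𝒳 → ℝ)) := measurable_one.indicator hB
  have hf : ∀ n, Measurable (f n) := fun n => by
    have : Measurable fun y : (Fin p → ℝ) × 𝒳 => B.indicator (1 : 𝒳 → ℝ) y.2 :=
      hind.comp measurable_snd
    fun_prop
  have hind0 : ∀ x, 0 ≤ B.indicator (1 : 𝒳 → ℝ) x := fun x =>
    Set.indicator_nonneg (fun _ _ => zero_le_one) x
  have hind1 : ∀ x, B.indicator (1 : 𝒳 → ℝ) x ≤ 1 := fun x => by
    by_cases hx : x ∈ B <;> simp [hx]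
  have hf0 : ∀ n y, 0 ≤ f n y := fun n y => mul_nonneg (hS.nonneg _) (hind0 _)
  have hfb : ∀ n y, f n y ≤ b := fun n y =>
    (mul_le_of_le_one_right (hS.nonneg _) (hind1 _)).trans (hb _)
  have hT : ∀ i, Measurable fun ω => (Z i ω, X i ω) := fun i => (hZ i).prodMk (hX i)
  have hmean : ∀ᶠ n in atTop, ∫ ω, f n (Z 0 ω, X 0 ω) ∂P =
      (kernelMass μ K (h n) z).toReal * m n := by
    filter_upwards [hM.eventually_gt_atTop 0] with n hn
    have hne : kernelMass μ K (h n) z ≠ 0 := by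
      intro h0
      simp [h0] at hn
    rw [integral_eq_lintegral_of_nonneg_ae (Eventually.of_forall fun ω => hf0 n _)
      ((hf n).comp (hT 0)).aestronglyMeasurable, ← ENNReal.toReal_mul]
    congr 1
    rw [← lintegral_map (f := fun y => ENNReal.ofReal (f n y)) (hf n).ennreal_ofReal (hT 0), hlaw,
      Measure.lintegral_compProd (hf n).ennreal_ofReal, lintegral_averagingKernel hK z hκB,
      ENNReal.mul_div_cancel hne (hS.kernelMass_ne_top _ _)]
    refine lintegral_congr fun u => ?_
    simp only [f]
    simp_rw [ENNReal.ofReal_mul (hS.nonneg _)]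
    rw [lintegral_const_mul _ hind.ennreal_ofReal, ← lintegral_indicator_one hB]
    congr 2
    ext x
    by_cases hx : x ∈ B <;> simp [hx]
  have hm1 : ∀ n, m n ≤ 1 := fun n => by
    refine ENNReal.toReal_le_of_le_ofReal zero_le_one ?_
    rw [ENNReal.ofReal_one]
    calc ∫⁻ u, κ u B ∂averagingKernel μ K (h n) z
        ≤ ∫⁻ _u, 1 ∂averagingKernel μ K (h n) z := lintegral_mono fun u => prob_le_one
      _ ≤ 1 := by
        rw [lintegral_one]
        exact averagingKernel_univ_le hK z
  have hdev : Tendsto (fun a : ℕ × Ω => (∑ i : Fin a.1, K ((h a.1)⁻¹ • (Z i a.2 - z)) /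
      (a.1 * (kernelMass μ K (h a.1) z).toReal) * B.indicator 1 (X i a.2)) - m a.1)
      (inProbability P) (𝓝 0) := by
    rw [Metric.tendsto_nhds]
    intro ε hε
    rw [Filter.Eventually, mem_inProbability]
    have hlim : Tendsto (fun n : ℕ => ENNReal.ofReal (b / ε ^ 2 *
        (n * (kernelMass μ K (h n) z).toReal)⁻¹)) atTop (𝓝 0) := by
      have := (tendsto_inv_atTop_zero.comp hM).const_mul (b / ε ^ 2)
      rw [mul_zero] at this
      simpa using ENNReal.tendsto_ofReal this
    refine tendsto_of_tendsto_of_tendsto_of_le_of_le' tendsto_const_nhds hlim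
      (Eventually.of_forall fun _ => zero_le) ?_
    filter_upwards [hM.eventually_gt_atTop 0, hmean] with n hn hmn
    set M : ℝ := n * (kernelMass μ K (h n) z).toReal with hMdef
    have hcheb := meas_abs_sum_sub_ge_le hT hindep hident (hf n) (hf0 n) (hfb n) n (mul_pos hε hn)
    rw [hmn] at hcheb
    refine (le_of_eq ?_).trans (hcheb.trans (ENNReal.ofReal_le_ofReal ?_))
    · congr 1
      ext ω
      simp only [Set.mem_ofPred_eq, not_lt, Real.dist_eq, sub_zero]
      have h1 : (∑ i : Fin n, K ((h n)⁻¹ • (Z i ω - z)) / M * B.indicator 1 (X i ω)) - m n =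
          (∑ i : Fin n, f n (Z i ω, X i ω) -
            n * ((kernelMass μ K (h n) z).toReal * m n)) / M := by
        rw [← mul_assoc, ← hMdef, sub_div, mul_div_cancel_left₀ _ hn.ne', Finset.sum_div]
        congr 1
        refine Finset.sum_congr rfl fun i _ => ?_
        simp only [f]
        ring
      rw [h1, abs_div, abs_of_pos hn, le_div_iff₀ hn]
    · have h2 : (n : ℝ) * (b * ((kernelMass μ K (h n) z).toReal * m n)) ≤ b * M := by
        have : (n : ℝ) * (b * ((kernelMass μ K (h n) z).toReal * m n)) = b * M * m n := by
          rw [hMdef]; ring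
        rw [this]
        exact mul_le_of_le_one_right (mul_nonneg hb0 hn.le) (hm1 n)
      calc _ ≤ b * M / (ε * M) ^ 2 := by gcongr
        _ = b / ε ^ 2 * M⁻¹ := by field_simp
  have h3 := hdev.add (hm.comp tendsto_fst_inProbability)
  rw [zero_add] at h3
  refine h3.congr fun a => ?_
  simp

omit [IsProbabilityMeasure P] [IsMarkovKernel κ] in
/-- For the indicator of a rectangle the sum over all maps factorizes into local averages, and the
maps that are not injective are negligible since every single weight is. -/
theorem StuteConsistency.tendsto_normalizedUStat_indicator (hS : StuteConsistency K h)
    {z : Fin k → Fin p → ℝ} {B : Fin k → Set 𝒳} {c : Fin k → ℝ} (hc : ∀ j, 0 < c j)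
    (hz : ∀ j, ∀ᶠ n in atTop, ENNReal.ofReal (c j * h n ^ p) ≤ kernelMass μ K (h n) (z j))
    (havg : ∀ j, Tendsto (fun a : ℕ × Ω => ∑ i : Fin a.1, K ((h a.1)⁻¹ • (Z i a.2 - z j)) /
      (a.1 * (kernelMass μ K (h a.1) (z j)).toReal) * (B j).indicator 1 (X i a.2))
      (inProbability P) (𝓝 (κ (z j) (B j)).toReal)) :
    Tendsto (fun a : ℕ × Ω => normalizedUStat μ K (h a.1) ((Set.univ.pi B).indicator 1) a.1
      (fun i => X i a.2) (fun i => Z i a.2) z)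
      (inProbability P) (𝓝 (∏ j, (κ (z j) (B j)).toReal)) := by
  obtain ⟨b, hb0, hb⟩ := hS.exists_le
  let Y : (a : ℕ × Ω) → Fin k → Fin a.1 → ℝ := fun a j i => K ((h a.1)⁻¹ • (Z i a.2 - z j)) /
      (a.1 * (kernelMass μ K (h a.1) (z j)).toReal) * (B j).indicator 1 (X i a.2)
  let β : ℕ → Fin k → ℝ := fun n j => b * (n * (kernelMass μ K (h n) (z j)).toReal)⁻¹
  have hβ : ∀ j, Tendsto (fun a : ℕ × Ω => β a.1 j) (inProbability P) (𝓝 0) := fun j => by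
    have := (tendsto_inv_atTop_zero.comp (hS.tendsto_mul_kernelMass (hc j) (hz j))).const_mul b
    rw [mul_zero] at this
    exact this.comp tendsto_fst_inProbability
  have hY0 : ∀ a j i, 0 ≤ Y a j i := fun a j i =>
    mul_nonneg (div_nonneg (hS.nonneg _) (by positivity))
      (Set.indicator_nonneg (fun _ _ => zero_le_one) _)
  have hYβ : ∀ a j i, Y a j i ≤ β a.1 j := fun a j i => by
    have h1 : (B j).indicator (1 : 𝒳 → ℝ) (X i a.2) ≤ 1 := by
      by_cases hx : X i a.2 ∈ B j <;> simp [hx]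
    refine (mul_le_of_le_one_right (div_nonneg (hS.nonneg _) (by positivity)) h1).trans ?_
    simp only [β, div_eq_mul_inv]
    exact mul_le_mul_of_nonneg_right (hb _) (by positivity)
  have hprod : Tendsto (fun a : ℕ × Ω => ∏ j, ∑ i, Y a j i) (inProbability P)
      (𝓝 (∏ j, (κ (z j) (B j)).toReal)) := tendsto_finsetProd _ fun j _ => havg j
  have herr : Tendsto (fun a : ℕ × Ω => ∑ jj ∈ (Finset.univ : Finset (Fin k)).offDiag,
      β a.1 jj.1 * ∏ l : {l // l ≠ jj.1}, ∑ i, Y a l i) (inProbability P) (𝓝 0) := by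
    have h1 : ∀ jj ∈ (Finset.univ : Finset (Fin k)).offDiag, Tendsto (fun a : ℕ × Ω =>
        β a.1 jj.1 * ∏ l : {l // l ≠ jj.1}, ∑ i, Y a l i) (inProbability P) (𝓝 0) := by
      intro jj _
      have := (hβ jj.1).mul (tendsto_finsetProd (Finset.univ : Finset {l // l ≠ jj.1})
        fun l _ => havg l)
      rwa [zero_mul] at this
    simpa using tendsto_finsetSum _ h1
  have hdiff := squeeze_zero_norm
    (f := fun a : ℕ × Ω => ∑ σ : Fin k ↪ Fin a.1, ∏ l, Y a l (σ l) - ∏ l, ∑ i, Y a l i)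
    (fun a => abs_sum_embedding_sub_prod_le (hY0 a) (hYβ a)) herr
  have hsum := hdiff.add hprod
  rw [zero_add] at hsum
  refine hsum.congr fun a => ?_
  rw [sub_add_cancel, normalizedUStat]
  refine Finset.sum_congr rfl fun σ _ => ?_
  rw [Finset.prod_mul_distrib]
  congr 1
  by_cases hx : (fun j => X (σ j) a.2) ∈ Set.univ.pi B
  · rw [Set.indicator_of_mem hx]
    exact Finset.prod_eq_one fun j _ => Set.indicator_of_mem (hx j (Set.mem_univ j)) _
  · rw [Set.indicator_of_notMem hx]
    obtain ⟨j, hj⟩ : ∃ j, X (σ j) a.2 ∉ B j := by simpa [Set.mem_pi] using hx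
    exact Finset.prod_eq_zero (Finset.mem_univ j) (Set.indicator_of_notMem hj _)

theorem ae_pi_of_ae {q : (Fin p → ℝ) → Prop} (hq : ∀ᵐ z ∂μ, q z) :
    ∀ᵐ z ∂Measure.pi (fun _ : Fin k => μ), ∀ j, q (z j) :=
  ae_all_iff.2 fun j => (Measure.quasiMeasurePreserving_eval (fun _ : Fin k => μ) j).ae hq

theorem integrable_of_mem_rectSpan {f : (Fin k → 𝒳) → ℝ} (hf : f ∈ rectSpan 𝒳 k)
    (ρ : Measure (Fin k → 𝒳)) [IsFiniteMeasure ρ] : Integrable f ρ := by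
  obtain ⟨hm, b, hb⟩ := rectSpan_measurable_and_bounded hf
  exact Integrable.of_bound hm.aestronglyMeasurable b (Eventually.of_forall hb)

/-- The exceptional null set may depend on `f`; only countably many `f` are used below. -/
theorem StuteConsistency.ae_tendsto_normalizedUStat_of_mem_rectSpan (hS : StuteConsistency K h)
    (hK : Measurable K) (hpos : ∀ n, 0 < h n)
    (hX : ∀ i, Measurable (X i)) (hZ : ∀ i, Measurable (Z i))
    (hindep : iIndepFun (fun i ω => (Z i ω, X i ω)) P)
    (hident : ∀ i, IdentDistrib (fun ω => (Z i ω, X i ω)) (fun ω => (Z 0 ω, X 0 ω)) P P)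
    (hlaw : P.map (fun ω => (Z 0 ω, X 0 ω)) = μ ⊗ₘ κ)
    {f : (Fin k → 𝒳) → ℝ} (hf : f ∈ rectSpan 𝒳 k) :
    ∀ᵐ z ∂Measure.pi (fun _ : Fin k => μ),
      Tendsto (fun a : ℕ × Ω => normalizedUStat μ K (h a.1) f a.1
        (fun i => X i a.2) (fun i => Z i a.2) z)
        (inProbability P) (𝓝 (∫ x, f x ∂piKernel κ k z)) := by
  induction hf using Submodule.span_induction with
  | mem f hf =>
    obtain ⟨B, hB, rfl⟩ := hf
    have hmean : ∀ᵐ z ∂Measure.pi (fun _ : Fin k => μ), ∀ j,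
        Tendsto (fun n => ∫⁻ u, κ u (B j) ∂averagingKernel μ K (h n) (z j)) atTop
          (𝓝 (κ (z j) (B j))) :=
      ae_all_iff.2 fun j => (Measure.quasiMeasurePreserving_eval (fun _ : Fin k => μ) j).ae
        (hS.ae_tendsto_lintegral_averagingKernel hK hpos (κ.measurable_coe (hB j))
          fun _ => prob_le_one)
    filter_upwards [ae_pi_of_ae (hS.ae_kernelMass_ge (μ := μ) hpos), hmean] with z hz1 hz2
    choose c hc hzc using hz1
    have hint : ∫ x, (Set.univ.pi B).indicator 1 x ∂piKernel κ k z =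
        ∏ j, (κ (z j) (B j)).toReal := by
      rw [integral_indicator_one (MeasurableSet.univ_pi hB), Measure.real, piKernel_apply,
        Measure.pi_pi, ENNReal.toReal_prod]
    rw [hint]
    exact hS.tendsto_normalizedUStat_indicator hc hzc fun j =>
      hS.tendsto_localAverage hK hX hZ hindep hident hlaw (hB j) (hc j) (hzc j) (hz2 j)
  | zero =>
    refine Eventually.of_forall fun z => ?_
    simpa [normalizedUStat] using tendsto_const_nhds
  | add f g hf hg ihf ihg =>
    filter_upwards [ihf, ihg] with z hzf hzg
    have h1 : ∫ x, (f + g) x ∂piKernel κ k z =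
        ∫ x, f x ∂piKernel κ k z + ∫ x, g x ∂piKernel κ k z :=
      integral_add (integrable_of_mem_rectSpan hf _) (integrable_of_mem_rectSpan hg _)
    rw [h1]
    refine (hzf.add hzg).congr fun a => ?_
    simp only [normalizedUStat, Pi.add_apply, mul_add, Finset.sum_add_distrib]
  | smul c f hf ihf =>
    filter_upwards [ihf] with z hzf
    have h1 : ∫ x, (c • f) x ∂piKernel κ k z = c * ∫ x, f x ∂piKernel κ k z :=
      integral_const_mul c _
    rw [h1]
    refine (hzf.const_mul c).congr fun a => ?_
    simp only [normalizedUStat, Pi.smul_apply, smul_eq_mul, Finset.mul_sum]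
    exact Finset.sum_congr rfl fun σ _ => by ring

end UStatistic

section Consistency

variable {Ω 𝒳 : Type*} [MeasurableSpace Ω] [MeasurableSpace 𝒳] {P : Measure Ω}
  [IsProbabilityMeasure P] {p k : ℕ} {X : ℕ → Ω → 𝒳} {Z : ℕ → Ω → Fin p → ℝ}
  {μ : Measure (Fin p → ℝ)} [IsProbabilityMeasure μ]
  {κ : Kernel (Fin p → ℝ) 𝒳} [IsMarkovKernel κ] {K : (Fin p → ℝ) → ℝ} {h : ℕ → ℝ}

/-- Any `k` distinct members of an i.i.d. sequence have the same joint law. -/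
theorem map_injective_tuple_eq_pi {α : Type*} [MeasurableSpace α] {T : ℕ → Ω → α}
    (hT : ∀ i, Measurable (T i)) (hindep : iIndepFun T P)
    (hident : ∀ i, IdentDistrib (T i) (T 0) P P) {s : Fin k → ℕ} (hs : Function.Injective s) :
    P.map (fun ω j => T (s j) ω) = Measure.pi fun _ => P.map (T 0) := by
  rw [(iIndepFun_iff_map_fun_eq_pi_map fun j => (hT (s j)).aemeasurable).1 (hindep.precomp hs)]
  congr 1
  exact funext fun j => (hident (s j)).map_eq

theorem lintegral_pi_averagingKernel (hK : Measurable K) (b : ℝ) (z : Fin k → Fin p → ℝ)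
    {F : (Fin k → Fin p → ℝ) → ℝ≥0∞} (hF : Measurable F) :
    ∫⁻ u, F u ∂Measure.pi (fun j => averagingKernel μ K b (z j)) =
      ∫⁻ u, (∏ j, ENNReal.ofReal (K (b⁻¹ • (u j - z j))) / kernelMass μ K b (z j)) * F u
        ∂Measure.pi (fun _ => μ) := by
  have hw : ∀ j, Measurable fun u => ENNReal.ofReal (K (b⁻¹ • (u - z j))) /
      kernelMass μ K b (z j) := fun j =>
    (measurable_kernel_div_mass hK b).comp measurable_prodMk_left
  have hfin : ∀ j, IsFiniteMeasure (μ.withDensity fun u => ENNReal.ofReal (K (b⁻¹ • (u - z j))) /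
      kernelMass μ K b (z j)) := fun j => by
    rw [← averagingKernel_apply hK]
    exact ⟨(averagingKernel_univ_le hK _).trans_lt ENNReal.one_lt_top⟩
  simp_rw [averagingKernel_apply hK]
  exact lintegral_pi_withDensity hw hfin hF

/-- The mean of the normalized U-statistic is bounded by the kernel average of the conditional
mean of `|f|`. -/
theorem StuteConsistency.lintegral_enorm_normalizedUStat_le (hS : StuteConsistency K h)
    (hK : Measurable K)
    (hX : ∀ i, Measurable (X i)) (hZ : ∀ i, Measurable (Z i))
    (hindep : iIndepFun (fun i ω => (Z i ω, X i ω)) P)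
    (hident : ∀ i, IdentDistrib (fun ω => (Z i ω, X i ω)) (fun ω => (Z 0 ω, X 0 ω)) P P)
    (hlaw : P.map (fun ω => (Z 0 ω, X 0 ω)) = μ ⊗ₘ κ)
    {f : (Fin k → 𝒳) → ℝ} (hf : Measurable f) {n : ℕ} (hn : n ≠ 0) {z : Fin k → Fin p → ℝ}
    (hz : ∀ j, (kernelMass μ K (h n) (z j)).toReal ≠ 0) :
    ∫⁻ ω, ‖normalizedUStat μ K (h n) f n (fun i => X i ω) (fun i => Z i ω) z‖ₑ ∂P ≤
      ∫⁻ u, (∫⁻ x, ‖f x‖ₑ ∂piKernel κ k u)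
        ∂Measure.pi (fun j => averagingKernel μ K (h n) (z j)) := by
  have hT : ∀ i, Measurable fun ω => (Z i ω, X i ω) := fun i => (hZ i).prodMk (hX i)
  let w : Fin k → (Fin p → ℝ) → ℝ≥0∞ := fun j u =>
    ENNReal.ofReal (K ((h n)⁻¹ • (u - z j))) / kernelMass μ K (h n) (z j)
  have hw : ∀ j, Measurable (w j) := fun j =>
    (measurable_kernel_div_mass hK (h n)).comp measurable_prodMk_left
  have hF : Measurable fun u => ∫⁻ x, ‖f x‖ₑ ∂piKernel κ k u := hf.enorm.lintegral_kernel
  have hnw : ∀ j u, ‖K ((h n)⁻¹ • (u - z j)) / (n * (kernelMass μ K (h n) (z j)).toReal)‖ₑ =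
      (n : ℝ≥0∞)⁻¹ * w j u := by
    intro j u
    have hn0 : (0 : ℝ) < n := Nat.cast_pos.2 (Nat.pos_of_ne_zero hn)
    have hm0 : 0 < (kernelMass μ K (h n) (z j)).toReal :=
      ENNReal.toReal_nonneg.lt_of_ne (hz j).symm
    rw [Real.enorm_of_nonneg (div_nonneg (hS.nonneg _) (by positivity)),
      ENNReal.ofReal_div_of_pos (mul_pos hn0 hm0), ENNReal.ofReal_mul hn0.le,
      ENNReal.ofReal_toReal (hS.kernelMass_ne_top _ _), ENNReal.ofReal_natCast, div_eq_mul_inv,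
      ENNReal.mul_inv (Or.inl (Nat.cast_ne_zero.2 hn)) (Or.inl (ENNReal.natCast_ne_top n))]
    simp only [w, div_eq_mul_inv]
    ring
  let Φ : (Fin k → (Fin p → ℝ) × 𝒳) → ℝ≥0∞ := fun y =>
    (∏ j, w j (y j).1) * ‖f fun j => (y j).2‖ₑ
  have hΦ : Measurable Φ := by
    refine Measurable.mul (Finset.measurable_prod _ fun j _ => (hw j).comp (by fun_prop)) ?_
    exact (hf.comp (by fun_prop : Measurable fun (y : Fin k → (Fin p → ℝ) × 𝒳) j =>
      (y j).2)).enorm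
  have hterm : ∀ σ : Fin k ↪ Fin n,
      ∫⁻ ω, ‖(∏ j, K ((h n)⁻¹ • (Z (σ j) ω - z j)) /
        (n * (kernelMass μ K (h n) (z j)).toReal)) * f fun j => X (σ j) ω‖ₑ ∂P =
      (n : ℝ≥0∞)⁻¹ ^ k * ∫⁻ u, (∫⁻ x, ‖f x‖ₑ ∂piKernel κ k u)
        ∂Measure.pi (fun j => averagingKernel μ K (h n) (z j)) := by
    intro σ
    have hσ : Function.Injective fun j => (σ j : ℕ) := Fin.val_injective.comp σ.injective
    have h1 : ∀ ω, ‖(∏ j, K ((h n)⁻¹ • (Z (σ j) ω - z j)) /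
        (n * (kernelMass μ K (h n) (z j)).toReal)) * f fun j => X (σ j) ω‖ₑ =
        (n : ℝ≥0∞)⁻¹ ^ k * Φ fun j => (Z (σ j) ω, X (σ j) ω) := by
      intro ω
      rw [enorm_mul, enorm_eq_nnnorm, nnnorm_prod, ENNReal.ofNNReal_finsetProd]
      simp_rw [← enorm_eq_nnnorm, hnw]
      rw [Finset.prod_mul_distrib, Finset.prod_const, Finset.card_univ, Fintype.card_fin, mul_assoc]
    simp_rw [h1]
    have hTσ : Measurable fun ω j => (Z (σ j) ω, X (σ j) ω) :=
      measurable_pi_iff.2 fun j => hT (σ j)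
    have hΦT : Measurable fun ω => Φ fun j => (Z (σ j) ω, X (σ j) ω) := hΦ.comp hTσ
    rw [lintegral_const_mul _ hΦT, ← lintegral_map hΦ hTσ,
      map_injective_tuple_eq_pi hT hindep hident hσ, hlaw, lintegral_pi_compProd hΦ,
      lintegral_pi_averagingKernel hK _ _ hF]
    congr 1
    refine lintegral_congr fun u => ?_
    exact lintegral_const_mul (∏ j, w j (u j)) hf.enorm
  have hmeas : ∀ σ : Fin k ↪ Fin n, Measurable fun ω => ‖(∏ j, K ((h n)⁻¹ • (Z (σ j) ω - z j)) /
        (n * (kernelMass μ K (h n) (z j)).toReal)) * f fun j => X (σ j) ω‖ₑ := by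
    intro σ
    refine (Measurable.mul (Finset.measurable_prod _ fun j _ => ?_) (hf.comp ?_)).enorm
    · exact (hK.comp (((hZ (σ j)).sub_const (z j)).const_smul (h n)⁻¹)).div_const _
    · exact measurable_pi_iff.2 fun j => hX (σ j)
  calc _ ≤ ∫⁻ ω, ∑ σ : Fin k ↪ Fin n, ‖(∏ j, K ((h n)⁻¹ • (Z (σ j) ω - z j)) /
        (n * (kernelMass μ K (h n) (z j)).toReal)) * f fun j => X (σ j) ω‖ₑ ∂P :=
        lintegral_mono fun ω => enorm_sum_le _ _
    _ = (Fintype.card (Fin k ↪ Fin n) : ℝ≥0∞) * ((n : ℝ≥0∞)⁻¹ ^ k *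
          ∫⁻ u, (∫⁻ x, ‖f x‖ₑ ∂piKernel κ k u)
            ∂Measure.pi (fun j => averagingKernel μ K (h n) (z j))) := by
        rw [lintegral_finsetSum _ fun σ _ => hmeas σ, Finset.sum_congr rfl fun σ _ => hterm σ,
          Finset.sum_const, Finset.card_univ, nsmul_eq_mul]
    _ ≤ (n : ℝ≥0∞) ^ k * ((n : ℝ≥0∞)⁻¹ ^ k *
          ∫⁻ u, (∫⁻ x, ‖f x‖ₑ ∂piKernel κ k u)
            ∂Measure.pi (fun j => averagingKernel μ K (h n) (z j))) := by
        gcongr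
        rw [Fintype.card_embedding_eq, Fintype.card_fin, Fintype.card_fin]
        exact_mod_cast Nat.descFactorial_le_pow n k
    _ = _ := by
        rw [← mul_assoc, ← mul_pow, ENNReal.mul_inv_cancel (Nat.cast_ne_zero.2 hn)
          (ENNReal.natCast_ne_top n), one_pow, one_mul]

omit [IsProbabilityMeasure P] [IsProbabilityMeasure μ] in
theorem measurable_normalizedUStat (hK : Measurable K) (hX : ∀ i, Measurable (X i))
    (hZ : ∀ i, Measurable (Z i)) (b : ℝ) {f : (Fin k → 𝒳) → ℝ} (hf : Measurable f) (n : ℕ)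
    (z : Fin k → Fin p → ℝ) :
    Measurable fun ω => normalizedUStat μ K b f n (fun i => X i ω) (fun i => Z i ω) z := by
  refine Finset.measurable_sum _ fun σ _ =>
    Measurable.mul (Finset.measurable_prod _ fun j _ => ?_) (hf.comp ?_)
  · exact (hK.comp (((hZ (σ j)).sub_const (z j)).const_smul b⁻¹)).div_const _
  · exact measurable_pi_iff.2 fun j => hX (σ j)

/-- Passing from `f` to its conditional mean does not increase the `L^q` norm. -/
theorem lintegral_piKernel_rpow_le {q : ℝ} (hq : 1 ≤ q) {f : (Fin k → 𝒳) → ℝ} (hf : Measurable f) :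
    (∫⁻ u, (∫⁻ x, ‖f x‖ₑ ∂piKernel κ k u) ^ q ∂Measure.pi (fun _ : Fin k => μ)) ^ q⁻¹ ≤
      eLpNorm f (ENNReal.ofReal q) (Measure.pi fun _ : Fin k => κ ∘ₘ μ) := by
  have hq0 : 0 < q := zero_lt_one.trans_le hq
  rw [eLpNorm_eq_lintegral_rpow_enorm_toReal (ENNReal.ofReal_pos.2 hq0).ne' ENNReal.ofReal_ne_top,
    ENNReal.toReal_ofReal hq0.le, one_div, lintegral_pi_comp (hf.enorm.pow_const q)]
  gcongr with u
  exact lintegral_rpow_le_lintegral_rpow hf.enorm hq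

/-- Consistency of the conditional U-statistic at almost every tuple of points, for `g` in `L^q`.
Linear combinations `f` of indicators of rectangles are handled directly; the error made in
replacing `g` by `f` is, in mean, a kernel average of the conditional mean of `|g - f|`, which the
iterated maximal inequality makes small almost everywhere and uniformly in the bandwidth. -/
theorem StuteConsistency.ae_tendsto_condUStat (hS : StuteConsistency K h)
    (hK : Measurable K) (hpos : ∀ n, 0 < h n) (hk : 0 < k)
    (hX : ∀ i, Measurable (X i)) (hZ : ∀ i, Measurable (Z i))
    (hindep : iIndepFun (fun i ω => (Z i ω, X i ω)) P)
    (hident : ∀ i, IdentDistrib (fun ω => (Z i ω, X i ω)) (fun ω => (Z 0 ω, X 0 ω)) P P)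
    (hlaw : P.map (fun ω => (Z 0 ω, X 0 ω)) = μ ⊗ₘ κ)
    {g : (Fin k → 𝒳) → ℝ} (hg : Measurable g) {q : ℝ} (hq1 : 1 ≤ q) (hq : 2 ≤ k → 1 < q)
    (hgq : MemLp g (ENNReal.ofReal q) (Measure.pi fun _ : Fin k => κ ∘ₘ μ)) :
    ∀ᵐ z ∂Measure.pi (fun _ : Fin k => μ),
      Tendsto (fun a : ℕ × Ω => condUStat K (h a.1) g a.1
        (fun i => X i a.2) (fun i => Z i a.2) z)
        (inProbability P) (𝓝 (condFunctional κ g z)) := by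
  have hS' := hS
  obtain ⟨H, hH, hH0, -, c₁, hc₁, c₂, hc₂, hKH⟩ := hS'.envelope
  obtain ⟨C, hC, hw⟩ := exists_weakTypeOne_averagingKernel (μ := μ) hK hpos hH hH0 hc₁ hc₂ hKH
  have hsf : ∀ n, IsFiniteKernel (averagingKernel μ K (h n)) := fun n =>
    ⟨1, ENNReal.one_lt_top, fun z => averagingKernel_univ_le hK z⟩
  obtain ⟨D, hD, hmaj⟩ := hw.exists_majorant hC (fun n z => averagingKernel_univ_le hK z) hk hq1 hq
  have hq1' : 1 ≤ ENNReal.ofReal q := ENNReal.one_le_ofReal.2 hq1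
  have happ : ∀ m : ℕ, ∃ f ∈ rectSpan 𝒳 k, eLpNorm (g - f) (ENNReal.ofReal q)
      (Measure.pi fun _ : Fin k => κ ∘ₘ μ) ≤ (4⁻¹ : ℝ≥0∞) ^ m := fun m =>
    hgq.exists_rectSpan_eLpNorm_sub_le hq1' ENNReal.ofReal_ne_top (pow_ne_zero m (by simp))
  choose f hf hfm using happ
  have hfmeas : ∀ m, Measurable (f m) := fun m => (rectSpan_measurable_and_bounded (hf m)).1
  have hF : ∀ m, Measurable fun u => ∫⁻ x, ‖g x - f m x‖ₑ ∂piKernel κ k u := fun m =>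
    (hg.sub (hfmeas m)).enorm.lintegral_kernel
  choose G hG hFG hGavg hGweak using fun m => hmaj _ (hF m)
  have hGlim : ∀ᵐ z ∂Measure.pi (fun _ : Fin k => μ), Tendsto (fun m => G m z) atTop (𝓝 0) :=
    ae_tendsto_zero_of_weakType hD fun m t => (hGweak m t).trans (by
      gcongr
      exact (lintegral_piKernel_rpow_le hq1 (hg.sub (hfmeas m))).trans (hfm m))
  have hone : (1 : (Fin k → 𝒳) → ℝ) ∈ rectSpan 𝒳 k := by
    have := indicator_pi_mem_rectSpan (𝒳 := 𝒳) (k := k) (B := fun _ => Set.univ)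
      fun _ => MeasurableSet.univ
    rwa [Set.pi_univ, Set.indicator_univ] at this
  have hrect := fun {f'} (hf' : f' ∈ rectSpan 𝒳 k) =>
    hS.ae_tendsto_normalizedUStat_of_mem_rectSpan (κ := κ) (μ := μ) hK hpos hX hZ hindep hident
      hlaw hf'
  filter_upwards [hGlim, ae_all_iff.2 fun m => hrect (hf m), hrect hone,
    ae_pi_of_ae (hS.ae_kernelMass_ge (μ := μ) hpos)] with z hzG hzf hz1 hzmass
  have hmass : ∀ᶠ n in atTop, ∀ j, (kernelMass μ K (h n) (z j)).toReal ≠ 0 := by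
    refine eventually_all.2 fun j => ?_
    obtain ⟨c, hc, hzc⟩ := hzmass j
    filter_upwards [hzc] with n hn
    exact (ENNReal.toReal_pos ((ENNReal.ofReal_pos.2 (mul_pos hc (pow_pos (hpos n) p))).trans_le
      hn).ne' (hS.kernelMass_ne_top _ _)).ne'
  have hint : Integrable g (piKernel κ k z) := by
    obtain ⟨m, hm⟩ := (ENNReal.tendsto_nhds_zero.1 hzG 1 one_pos).exists
    have h1 : Integrable (g - f m) (piKernel κ k z) :=
      ⟨(hg.sub (hfmeas m)).aestronglyMeasurable,
        ((hFG m z).trans hm).trans_lt ENNReal.one_lt_top⟩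
    simpa using h1.add (integrable_of_mem_rectSpan (hf m) _)
  have hθ : Tendsto (fun m => ∫ x, f m x ∂piKernel κ k z) atTop
      (𝓝 (∫ x, g x ∂piKernel κ k z)) := by
    rw [tendsto_iff_edist_tendsto_0]
    refine tendsto_of_tendsto_of_tendsto_of_le_of_le tendsto_const_nhds hzG (fun _ => zero_le)
      fun m => ?_
    dsimp only
    rw [edist_comm, edist_eq_enorm_sub,
      ← integral_sub hint (integrable_of_mem_rectSpan (hf m) _)]
    exact (enorm_integral_le_lintegral_enorm _).trans (hFG m z)
  have hnum : Tendsto (fun a : ℕ × Ω => normalizedUStat μ K (h a.1) g a.1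
      (fun i => X i a.2) (fun i => Z i a.2) z) (inProbability P)
      (𝓝 (∫ x, g x ∂piKernel κ k z)) := by
    refine tendsto_inProbability_of_approx
      (V := fun n ω => normalizedUStat μ K (h n) g n (fun i => X i ω) (fun i => Z i ω) z)
      (U := fun m n ω => normalizedUStat μ K (h n) (f m) n (fun i => X i ω) (fun i => Z i ω) z)
      (fun m n => ((measurable_normalizedUStat hK hX hZ _ hg n z).sub
        (measurable_normalizedUStat hK hX hZ _ (hfmeas m) n z)).aemeasurable)
      hzf (fun m => ?_) hzG hθ
    filter_upwards [hmass, eventually_ne_atTop 0] with n hn hn0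
    refine le_trans (le_of_eq ?_) ((hS.lintegral_enorm_normalizedUStat_le (κ := κ) hK hX hZ hindep
      hident hlaw (hg.sub (hfmeas m)) hn0 hn).trans (hGavg m n z))
    refine lintegral_congr fun ω => ?_
    simp only [normalizedUStat, Pi.sub_apply, mul_sub, Finset.sum_sub_distrib]
  have hden : ∫ x, (1 : (Fin k → 𝒳) → ℝ) x ∂piKernel κ k z = 1 := by simp
  rw [hden] at hz1
  have hdiv := hnum.div hz1 one_ne_zero
  rw [div_one] at hdiv
  refine hdiv.congr' ?_
  filter_upwards [tendsto_fst_inProbability.eventually hmass,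
    tendsto_fst_inProbability.eventually (eventually_ne_atTop 0)] with a ha ha0
  exact (condUStat_eq_div (hpos _) ha0 ha g _ _).symm

end Consistency

/-! ### Consistency of the penalized estimator -/

theorem mainTheorem8 {Ω 𝒳 : Type*} [MeasurableSpace Ω] [MeasurableSpace 𝒳]
    (P : Measure Ω) [IsProbabilityMeasure P] (p k r : ℕ) (hk : 0 < k)
    -- the i.i.d. sample, and a regular version `κ` of the conditional law of `X` given `Z`
    (X : ℕ → Ω → 𝒳) (Z : ℕ → Ω → Fin p → ℝ)
    (hX : ∀ i, Measurable (X i)) (hZ : ∀ i, Measurable (Z i))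
    (hindep : iIndepFun (fun i ω => (Z i ω, X i ω)) P)
    (hident : ∀ i, IdentDistrib (fun ω => (Z i ω, X i ω)) (fun ω => (Z 0 ω, X 0 ω)) P P)
    (κ : Kernel (Fin p → ℝ) 𝒳) [IsMarkovKernel κ]
    (hκ : P.map (fun ω => (Z 0 ω, X 0 ω)) = P.map (Z 0) ⊗ₘ κ)
    -- the function `g` and its moment
    (g : (Fin k → 𝒳) → ℝ) (hg : Measurable g) (q : ℝ≥0∞) (hq1 : 1 ≤ q) (hq : 2 ≤ k → 1 < q)
    (hgq : MemLp g q (Measure.pi fun _ : Fin k => P.map (X 0)))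
    -- kernel and bandwidths
    (K : (Fin p → ℝ) → ℝ) (hK : Measurable K) (h : ℕ → ℝ) (hpos : ∀ n, 0 < h n)
    (hStute : StuteConsistency K h)
    -- the parametric model with link function `Λ`
    (𝒵 : Set (Fin p → ℝ)) (Λ : ℝ → ℝ) (I : Set ℝ) (hI : IsOpen I)
    (hΛmono : StrictMonoOn Λ I) (hΛdiff : ContDiffOn ℝ 1 Λ I)
    (ψ : (Fin k → Fin p → ℝ) → Fin r → ℝ) (βstar : Fin r → ℝ)
    (hmodel : ∀ z : Fin k → Fin p → ℝ, (∀ i, z i ∈ 𝒵) →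
      condFunctional κ g z ∈ I ∧ Λ (condFunctional κ g z) = ψ z ⬝ᵥ βstar) :
    ∃ N : Set (Fin k → Fin p → ℝ), (Measure.pi fun _ : Fin k => P.map (Z 0)) N = 0 ∧
      ∀ (n' : ℕ), k ≤ n' →
      ∀ (z' : Fin n' → Fin p → ℝ), (∀ i, z' i ∈ 𝒵) →
      ∀ (S : Finset (Fin k ↪ Fin n')), (∀ σ ∈ S, designTuple z' σ ∉ N) →
      ∀ (lam : ℕ → ℝ) (lam0 : ℝ), (∀ n, 0 ≤ lam n) → Tendsto lam atTop (𝓝 lam0) →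
      ∀ (βhat : ℕ → Ω → Fin r → ℝ),
        (∀ n ω, βhat n ω ∈ argminSet (penalizedCriterion S z' Λ
          (condUStat K (h n) g n (fun i => X i ω) (fun i => Z i ω)) ψ (lam n))) →
        ((argminSet (limitCriterion S z' ψ βstar lam0)).Nonempty ∧
          TendstoInMeasure P
            (fun n ω => Metric.infDist (βhat n ω) (argminSet (limitCriterion S z' ψ βstar lam0)))
            atTop (fun _ => (0 : ℝ))) ∧
        (∀ βlim : Fin r → ℝ, argminSet (limitCriterion S z' ψ βstar lam0) = {βlim} →
          TendstoInMeasure P βhat atTop (fun _ => βlim)) ∧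
        (lam0 = 0 →
          Submodule.span ℝ ((fun σ => ψ (designTuple z' σ)) '' (S : Set (Fin k ↪ Fin n'))) = ⊤ →
          TendstoInMeasure P βhat atTop (fun _ => βstar)) := by
  have hμ : IsProbabilityMeasure (P.map (Z 0)) :=
    Measure.isProbabilityMeasure_map (hZ 0).aemeasurable
  have hlawX : P.map (X 0) = κ ∘ₘ P.map (Z 0) := by
    rw [← Measure.snd_compProd, ← hκ, Measure.snd, Measure.map_map measurable_snd
      ((hZ 0).prodMk (hX 0))]
    rfl
  -- A finite exponent is needed for the approximation by indicators of rectangles.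
  obtain ⟨q', hq'1, hq', hgq'⟩ : ∃ q' : ℝ, 1 ≤ q' ∧ (2 ≤ k → 1 < q') ∧
      MemLp g (ENNReal.ofReal q') (Measure.pi fun _ : Fin k => κ ∘ₘ P.map (Z 0)) := by
    have hfin : min q 2 ≠ ∞ := ne_top_of_le_ne_top ENNReal.ofNat_ne_top (min_le_right _ _)
    refine ⟨(min q 2).toReal, ?_, fun h2 => ?_, ?_⟩
    · rw [← ENNReal.toReal_one]
      exact ENNReal.toReal_mono hfin (le_min hq1 one_le_two)
    · rw [← ENNReal.toReal_one, ENNReal.toReal_lt_toReal ENNReal.one_ne_top hfin]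
      exact lt_min (hq h2) ENNReal.one_lt_two
    · rw [ENNReal.ofReal_toReal hfin, ← hlawX]
      have : IsProbabilityMeasure (P.map (X 0)) :=
        Measure.isProbabilityMeasure_map (hX 0).aemeasurable
      exact hgq.mono_exponent (min_le_left _ _)
  have hae := hStute.ae_tendsto_condUStat hK hpos hk hX hZ hindep hident hκ hg hq'1 hq' hgq'
  refine ⟨_, hae, fun n' _ z' hz' S hS lam lam0 hlam_nonneg hlam βhat hβ => ?_⟩
  have hlam0 : 0 ≤ lam0 := ge_of_tendsto' hlam hlam_nonneg
  let c : ℝ := ((n' - k).factorial : ℝ) / (n'.factorial : ℝ)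
  have hc : 0 < c := div_pos (Nat.cast_pos.2 (Nat.factorial_pos _))
    (Nat.cast_pos.2 (Nat.factorial_pos _))
  let v : (Fin k ↪ Fin n') → Fin r → ℝ := fun σ => ψ (designTuple z' σ)
  have hy : ∀ σ ∈ S, Tendsto (fun a : ℕ × Ω => Λ (condUStat K (h a.1) g a.1 (fun i => X i a.2)
      (fun i => Z i a.2) (designTuple z' σ))) (inProbability P) (𝓝 (v σ ⬝ᵥ βstar)) := by
    intro σ hσ
    obtain ⟨hmem, heq⟩ := hmodel (designTuple z' σ) fun i => hz' (σ i)
    have hcont : ContinuousAt Λ (condFunctional κ g (designTuple z' σ)) :=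
      hΛdiff.continuousOn.continuousAt (hI.mem_nhds hmem)
    have hcons := not_not.1 (hS σ hσ)
    have := hcont.tendsto.comp hcons
    rwa [heq] at this
  have hlam' : Tendsto (fun a : ℕ × Ω => lam a.1) (inProbability P) (𝓝 lam0) :=
    hlam.comp tendsto_fst_inProbability
  have hdist : Tendsto (fun a : ℕ × Ω => Metric.infDist (βhat a.1 a.2)
      (argminSet (limitCriterion S z' ψ βstar lam0))) (inProbability P) (𝓝 0) := by
    rcases hlam0.eq_or_lt with h0 | h0
    · subst h0
      exact tendsto_infDist_argminSet_of_eq_zero (β := fun a : ℕ × Ω => βhat a.1 a.2) (c := c)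
        (lam := fun a : ℕ × Ω => lam a.1) (v := v) hc hy (fun a => hlam_nonneg _) hlam'
        fun a => hβ a.1 a.2
    · exact tendsto_infDist_argminSet_of_pos (β := fun a : ℕ × Ω => βhat a.1 a.2) (c := c)
        (lam := fun a : ℕ × Ω => lam a.1) (v := v) hc h0 hy hlam' fun a => hβ a.1 a.2
  have hunique : ∀ βlim : Fin r → ℝ, argminSet (limitCriterion S z' ψ βstar lam0) = {βlim} →
      TendstoInMeasure P βhat atTop (fun _ => βlim) := by
    intro βlim hlim
    rw [tendstoInMeasure_const_iff, tendsto_iff_dist_tendsto_zero]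
    simpa only [hlim, Metric.infDist_singleton] using hdist
  refine ⟨⟨nonempty_argminSet_limit (v := v) hc hlam0, tendstoInMeasure_const_iff.2 hdist⟩,
    hunique, fun h0 hspan => hunique βstar ?_⟩
  subst h0
  have hval : limitCriterion S z' ψ βstar 0 βstar = 0 := by
    simp [limitCriterion]
  refine Set.Subset.antisymm (fun b hb => ?_) (Set.singleton_subset_iff.2 fun b => ?_)
  · -- A minimizer has the same fitted values as `βstar`, and these determine it.
    have h1 := hb βstar
    rw [hval, limitCriterion, zero_mul, add_zero] at h1
    have h2 : ∑ σ ∈ S, (v σ ⬝ᵥ (βstar - b)) ^ 2 = 0 :=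
      le_antisymm (nonpos_of_mul_nonpos_right h1 hc) (Finset.sum_nonneg fun _ _ => sq_nonneg _)
    have h3 : ∀ σ ∈ S, v σ ⬝ᵥ (βstar - b) = 0 := fun σ hσ => by
      simpa using (Finset.sum_eq_zero_iff_of_nonneg fun _ _ => sq_nonneg _).1 h2 σ hσ
    have h4 : ∀ w ∈ Submodule.span ℝ
        ((fun σ => ψ (designTuple z' σ)) '' (S : Set (Fin k ↪ Fin n'))),
        w ⬝ᵥ (βstar - b) = 0 := by
      intro w hw
      induction hw using Submodule.span_induction with
      | mem w hw =>
        obtain ⟨σ, hσ, rfl⟩ := hw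
        exact h3 σ hσ
      | zero => exact zero_dotProduct _
      | add w w' _ _ hw hw' => rw [add_dotProduct, hw, hw', add_zero]
      | smul t w _ hw => rw [smul_dotProduct, hw, smul_zero]
    have h5 := h4 (βstar - b) (by rw [hspan]; exact Submodule.mem_top)
    exact (sub_eq_zero.1 (dotProduct_self_eq_zero.1 h5)).symm
  · rw [hval, limitCriterion, zero_mul, add_zero]
    exact mul_nonneg hc.le (Finset.sum_nonneg fun _ _ => sq_nonneg _)
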